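/- Let $d \geq 1$ be an integer and let $\varepsilon > 0$ be real. Then there exist constants $C = C(d,\varepsilon) > 0$ and $c = c(d,\varepsilon) > 0$, depending only on $d$ and $\varepsilon$, such that the following holds. For every real $K \geq 1$, every finite set $A \subseteq \mathbb{Q}$ with $|A \cdot A| \leq K|A|$, where $A \cdot A = \{ab : a, b \in A\}$, and every polynomial $\varphi \in \mathbb{Q}[x]$ of degree $d$ with $\varphi(0) \neq 0$, one has $$\#\{(a_1,a_2) \in A \times A : a_1 = \varphi(a_2)\} \leq c\, K^{C} |A|^{\varepsilon}.$$ -/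

import Mathlib

open scoped Pointwise

/-!
Let `S` be the set of nonzero `a ∈ A` for which `φ a` is a nonzero element of `A`. It suffices to
bound `|S|`, since `φ` has at most `d` zeros. Both sides of the argument concern the points
`(a, φ a)` of the group `ℚˣ × ℚˣ`, for `a ∈ S`.

*Lower bound for the energy.* For every `k` the products of `k` of these points lie in `Aᵏ × Aᵏ`,
which has at most `K ^ (2k) |A|²` elements by Plünnecke's inequality. Hence for `T ⊆ S` the number
of solutions of `∏ x_i = ∏ y_i`, `∏ φ x_i = ∏ φ y_i` in `T` is at least
`|T| ^ (2k) / (K ^ (2k) |A|²)`; see `card_pow_le_card_pow_mul_energy`.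

*Almost orthogonality at a prime.* Fix `p` and sort the points by the `p`-adic valuation of `a`.
Outside boundedly many valuations, the terms of `φ` have different valuations at `a`, so that
`φ a = c_m a ^ m (1 + η)` with `|η|_p < 1` determined by, and injective in, the valuation of `a`.
There are boundedly many choices for the dominant and the second term. When they are fixed, the
two equations give `∏ (1 + η_i) = ∏ (1 + η_i')`, and this is impossible if one of the `η` dominates
all others. So every solution has two entries of equal valuation
(`exists_padicValRat_eq_of_prod_eq`), and by log-convexity of the mixed energies, which are
integrals over the dual group in disguise, the `2k`-norm is almost orthogonal over the fibres of
the valuation (`energy_le_of_collision`). Consequently, if the points of a set can be identified by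
at most `r` adaptive queries for valuations, a proportion `D ^ (-r)` of them has `k`-energy at most
`(C ^ r |T|) ^ k` (`exists_subset_energy_le`).

*Few queries suffice.* Call a set binary if it is the leaf set of a decision tree with two
branches at each node. A one-dimensional inequality of Prékopa–Leindler type shows by induction on
the tree that `|U| |X|² |Y|² ≤ |X Y U|⁴` for binary `U` (`IsBinary.card_mul_sq_le`); together with
Plünnecke's inequality, binary subsets of `A` have at most `K ^ 12` elements. On the other hand,
every finite `S` contains a binary set `U` and a set `B` with `|S| ≤ 2 |B| |U|` that is identified
by `log₂ |U|` queries (`exists_hasDepth_subset`). Thus `C ^ r` and `D ^ r` are bounded by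
powers of `K`, and comparing the two bounds for the energy gives `|S| ≤ c K ^ C |A| ^ (2 / k)`.
-/

/-! ### Sumsets with binary sets -/

/-- A one-dimensional Prékopa–Leindler inequality for functions with maximum `1`. It refines
`|I + J| ≥ |I| + |J| - 1`. -/
theorem sum_add_sum_sub_one_le_sum_add (n : ℕ) (a b γ : ℤ → ℝ) (i₀ j₀ : ℤ)
    (ha₀ : a i₀ = 1) (hb₀ : b j₀ = 1) (hγ : ∀ s, 0 ≤ γ s) :
    ∀ I J : Finset ℤ, I.card + J.card = n → i₀ ∈ I → j₀ ∈ J → (∀ i ∈ I, a i ≤ 1) →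
      (∀ j ∈ J, b j ≤ 1) → (∀ i ∈ I, ∀ j ∈ J, min (a i) (b j) ≤ γ (i + j)) →
      ∑ i ∈ I, a i + ∑ j ∈ J, b j - 1 ≤ ∑ s ∈ I + J, γ s := by
  induction n with
  | zero =>
    intro I J h hi hj
    have := Finset.card_pos.2 ⟨i₀, hi⟩
    omega
  | succ n ih =>
    intro I J hn hi₀ hj₀ ha hb hab
    -- An extreme pair of `I × J` is charged to the smaller of its two values, which is removed.
    have peel : ∀ i ∈ I, ∀ j ∈ J,
        (∀ i' ∈ I, ∀ j' ∈ J, i' + j' = i + j → i' = i ∧ j' = j) →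
        (i ≠ i₀ ∨ j ≠ j₀) → ∑ i ∈ I, a i + ∑ j ∈ J, b j - 1 ≤ ∑ s ∈ I + J, γ s := by
      intro i hi j hj hext hne
      have key : ∀ I' J' : Finset ℤ, I' ⊆ I → J' ⊆ J → (i ∉ I' ∨ j ∉ J') →
          γ (i + j) + ∑ s ∈ I' + J', γ s ≤ ∑ s ∈ I + J, γ s := by
        intro I' J' hI hJ h
        have hnot : i + j ∉ I' + J' := by
          intro hmem
          obtain ⟨x, hx, y, hy, hxy⟩ := Finset.mem_add.1 hmem
          obtain ⟨rfl, rfl⟩ := hext x (hI hx) y (hJ hy) hxy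
          tauto
        rw [← Finset.sum_insert hnot]
        refine Finset.sum_le_sum_of_subset_of_nonneg ?_ (fun s _ _ => hγ s)
        refine Finset.insert_subset (Finset.add_mem_add hi hj) (Finset.add_subset_add hI hJ)
      have hmin := hab i hi j hj
      by_cases hcase : i ≠ i₀ ∧ (a i ≤ b j ∨ j = j₀)
      · obtain ⟨hii, hle⟩ := hcase
        have hle' : a i ≤ b j := by
          rcases hle with h | h
          · exact h
          · rw [h, hb₀]; exact ha i hi
        rw [min_eq_left hle'] at hmin
        have h1 := ih (I.erase i) J (by
            have := Finset.card_pos.2 ⟨i, hi⟩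
            rw [Finset.card_erase_of_mem hi]; omega)
          (Finset.mem_erase.2 ⟨hii.symm, hi₀⟩) hj₀
          (fun x hx => ha x (Finset.mem_of_mem_erase hx)) hb
          (fun x hx => hab x (Finset.mem_of_mem_erase hx))
        have h2 := key (I.erase i) J (Finset.erase_subset _ _) subset_rfl
          (Or.inl (Finset.notMem_erase _ _))
        have h3 := Finset.add_sum_erase I a hi
        linarith
      · have hjj : j ≠ j₀ := by
          rintro rfl
          rcases hne with h | h
          · exact hcase ⟨h, Or.inr rfl⟩
          · exact h rfl
        have hle' : b j ≤ a i := by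
          by_cases hii : i = i₀
          · rw [hii, ha₀]; exact hb j hj
          · by_contra hcon
            exact hcase ⟨hii, Or.inl (not_le.1 hcon).le⟩
        rw [min_eq_right hle'] at hmin
        have h1 := ih I (J.erase j) (by
            have := Finset.card_pos.2 ⟨j, hj⟩
            rw [Finset.card_erase_of_mem hj]; omega)
          hi₀ (Finset.mem_erase.2 ⟨hjj.symm, hj₀⟩) ha
          (fun x hx => hb x (Finset.mem_of_mem_erase hx))
          (fun x hx y hy => hab x hx y (Finset.mem_of_mem_erase hy))
        have h2 := key I (J.erase j) subset_rfl (Finset.erase_subset _ _)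
          (Or.inr (Finset.notMem_erase _ _))
        have h3 := Finset.add_sum_erase J b hj
        linarith
    have hI : I.Nonempty := ⟨i₀, hi₀⟩
    have hJ : J.Nonempty := ⟨j₀, hj₀⟩
    by_cases hmax : I.max' hI ≠ i₀ ∨ J.max' hJ ≠ j₀
    · refine peel _ (I.max'_mem hI) _ (J.max'_mem hJ) ?_ hmax
      intro x hx y hy hxy
      have := I.le_max' x hx
      have := J.le_max' y hy
      omega
    by_cases hmin : I.min' hI ≠ i₀ ∨ J.min' hJ ≠ j₀
    · refine peel _ (I.min'_mem hI) _ (J.min'_mem hJ) ?_ hmin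
      intro x hx y hy hxy
      have := I.min'_le x hx
      have := J.min'_le y hy
      omega
    push Not at hmax hmin
    have hIs : I = {i₀} := by
      refine Finset.eq_singleton_iff_unique_mem.2 ⟨hi₀, fun x hx => ?_⟩
      have := I.le_max' x hx
      have := I.min'_le x hx
      omega
    have hJs : J = {j₀} := by
      refine Finset.eq_singleton_iff_unique_mem.2 ⟨hj₀, fun x hx => ?_⟩
      have := J.le_max' x hx
      have := J.min'_le x hx
      omega
    have := hab i₀ hi₀ j₀ hj₀
    subst hIs hJs
    simp_all

section Quasicube

variable {G ι : Type*} [CommGroup G] [DecidableEq G]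

/-- A finite set that is the leaf set of a binary decision tree: it is a singleton, or some
coordinate `v i` takes exactly two values on it and both fibres are again of this kind. The
coordinate may vary from node to node. -/
inductive IsBinary {G ι : Type*} [DecidableEq G] (v : ι → G → ℤ) : Finset G → Prop
  | singleton (x : G) : IsBinary v {x}
  | union (i : ι) (m n : ℤ) (U V : Finset G) (hne : m ≠ n) (hU : ∀ x ∈ U, v i x = m)
      (hV : ∀ x ∈ V, v i x = n) (bU : IsBinary v U) (bV : IsBinary v V) : IsBinary v (U ∪ V)

theorem exists_max_fiber {α : Type*} (w : α → ℤ) {X : Finset α} (hX : X.Nonempty) :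
    ∃ i ∈ X.image w, 0 < (X.filter (w · = i)).card ∧
      ∀ i' ∈ X.image w, (X.filter (w · = i')).card ≤ (X.filter (w · = i)).card := by
  obtain ⟨i, hi, hmax⟩ := Finset.exists_max_image (X.image w)
    (fun i => (X.filter (w · = i)).card) (hX.image w)
  refine ⟨i, hi, ?_, hmax⟩
  obtain ⟨x, hx, rfl⟩ := Finset.mem_image.1 hi
  exact Finset.card_pos.2 ⟨x, by simp [hx]⟩

theorem sum_fiber_card {α : Type*} (w : α → ℤ) (X : Finset α) :
    ∑ i ∈ X.image w, ((X.filter (w · = i)).card : ℝ) = X.card := by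
  rw [Finset.card_eq_sum_card_image w X]
  push_cast
  rfl

/-- The inductive step in the direction of `w`: if `θ` is a lower bound for the normalised growth
of all pairs of fibres, then `X * Y * U` grows by `θ` and by a factor that exceeds `1` unless `X`
and `Y` are concentrated on single fibres. -/
theorem card_mul_mul_ge_of_fibers (w : G → ℤ) (hw : ∀ x y, w (x * y) = w x + w y)
    (X Y U : Finset G) (u : ℤ) (hU : ∀ x ∈ U, w x = u) (θ : ℝ) (hθ : 0 < θ) (i₀ j₀ : ℤ)
    (hi₀ : i₀ ∈ X.image w) (hj₀ : j₀ ∈ Y.image w)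
    (hM : 0 < (X.filter (w · = i₀)).card) (hN : 0 < (Y.filter (w · = j₀)).card)
    (hX : ∀ i ∈ X.image w, (X.filter (w · = i)).card ≤ (X.filter (w · = i₀)).card)
    (hY : ∀ j ∈ Y.image w, (Y.filter (w · = j)).card ≤ (Y.filter (w · = j₀)).card)
    (hθU : ∀ i ∈ X.image w, ∀ j ∈ Y.image w,
      θ * √((X.filter (w · = i)).card * (Y.filter (w · = j)).card) ≤
        (X.filter (w · = i) * Y.filter (w · = j) * U).card) :
    θ * √((X.filter (w · = i₀)).card * (Y.filter (w · = j₀)).card) *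
      ((X.card : ℝ) / (X.filter (w · = i₀)).card + (Y.card : ℝ) / (Y.filter (w · = j₀)).card - 1)
      ≤ (X * Y * U).card := by
  set M : ℝ := ((X.filter (w · = i₀)).card : ℝ) with hMdef
  set N : ℝ := ((Y.filter (w · = j₀)).card : ℝ) with hNdef
  have hM' : 0 < M := by rw [hMdef]; exact_mod_cast hM
  have hN' : 0 < N := by rw [hNdef]; exact_mod_cast hN
  have hr : 0 < θ * √(M * N) := by positivity
  set γ : ℤ → ℝ := fun s => ((X * Y * U).filter (w · = s + u)).card / (θ * √(M * N)) with hγdef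
  have h1 := sum_add_sum_sub_one_le_sum_add _
    (fun i => ((X.filter (w · = i)).card : ℝ) / M) (fun j => ((Y.filter (w · = j)).card : ℝ) / N)
    γ i₀ j₀ (by simp only [← hMdef]; field_simp) (by simp only [← hNdef]; field_simp)
    (fun s => by positivity) (X.image w) (Y.image w) rfl hi₀ hj₀
    (fun i hi => by
      rw [div_le_one hM', hMdef]; exact_mod_cast hX i hi)
    (fun j hj => by
      rw [div_le_one hN', hNdef]; exact_mod_cast hY j hj)
    (fun i hi j hj => by
      set a : ℝ := ((X.filter (w · = i)).card : ℝ) with hadef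
      set b : ℝ := ((Y.filter (w · = j)).card : ℝ) with hbdef
      have ha : 0 ≤ a := by positivity
      have hb : 0 ≤ b := by positivity
      have hs : √(a * b) = √(M * N) * √((a / M) * (b / N)) := by
        rw [← Real.sqrt_mul (by positivity)]
        congr 1
        field_simp
      have hmin : min (a / M) (b / N) ≤ √((a / M) * (b / N)) := by
        refine Real.le_sqrt_of_sq_le ?_
        rw [sq]
        exact mul_le_mul (min_le_left _ _) (min_le_right _ _) (by positivity) (by positivity)
      refine hmin.trans ?_
      rw [hγdef]
      simp only
      rw [le_div_iff₀ hr]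
      have h2 := hθU i hi j hj
      have h3 : ((X.filter (w · = i) * Y.filter (w · = j) * U).card : ℝ) ≤
          ((X * Y * U).filter (w · = i + j + u)).card := by
        norm_cast
        refine Finset.card_le_card fun z hz => ?_
        obtain ⟨xy, hxy, c, hc, rfl⟩ := Finset.mem_mul.1 hz
        obtain ⟨x, hx, y, hy, rfl⟩ := Finset.mem_mul.1 hxy
        rw [Finset.mem_filter] at hx hy ⊢
        refine ⟨Finset.mul_mem_mul (Finset.mul_mem_mul hx.1 hy.1) hc, ?_⟩
        rw [hw, hw, hx.2, hy.2, hU c hc]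
      calc √((a / M) * (b / N)) * (θ * √(M * N)) = θ * √(a * b) := by rw [hs]; ring
        _ ≤ _ := h2.trans h3)
  rw [← Finset.sum_div, ← Finset.sum_div, sum_fiber_card, sum_fiber_card] at h1
  have h2 : ∑ s ∈ X.image w + Y.image w, γ s ≤ (X * Y * U).card / (θ * √(M * N)) := by
    rw [hγdef, ← Finset.sum_div]
    refine div_le_div_of_nonneg_right ?_ hr.le
    norm_cast
    rw [← Finset.card_biUnion]
    · refine Finset.card_le_card fun z hz => ?_
      obtain ⟨s, -, hz⟩ := Finset.mem_biUnion.1 hz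
      exact (Finset.mem_filter.1 hz).1
    · intro s _ t _ hst
      rw [Function.onFun, Finset.disjoint_left]
      intro z hz hz'
      have e1 := (Finset.mem_filter.1 hz).2
      have e2 := (Finset.mem_filter.1 hz').2
      omega
  have h3 := h1.trans h2
  rw [le_div_iff₀ hr] at h3
  linarith

/-- The first hypothesis is the stronger one for spread-out sets, the second for sets concentrated
on one fibre. -/
theorem pow_four_add_le_of_two_bounds {p q r x z T : ℝ} (hp : 0 < p) (hq : 0 < q) (hqp : q ≤ p)
    (hr : 0 < r) (hx : 1 ≤ x) (hz : 1 ≤ z) (h₁ : p * r * (x + z - 1) ≤ T)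
    (h₂ : (p + q) * r ≤ T) : (p ^ 4 + q ^ 4) * r ^ 4 * (x * z) ^ 2 ≤ T ^ 4 := by
  set y := √(x * z) with hy
  have hxz : 0 ≤ x * z := by positivity
  have hy2 : y ^ 2 = x * z := Real.sq_sqrt hxz
  have hy1 : 1 ≤ y := by
    rw [hy]; exact Real.one_le_sqrt.2 (by nlinarith)
  have hamgm : 2 * y ≤ x + z := by
    refine le_of_sq_le_sq ?_ (by positivity)
    nlinarith [sq_nonneg (x - z)]
  have hT : (p + q / 3) * r * y ≤ T := by
    by_cases hc : p ≤ y * (p - q / 3)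
    · refine le_trans ?_ h₁
      have : (p + q / 3) * y ≤ p * (x + z - 1) := by nlinarith
      nlinarith
    · refine le_trans ?_ h₂
      have : (p + q / 3) * y ≤ p + q := by
        push Not at hc
        have h5 : 0 < p - q / 3 := by linarith
        have h6 : (p + q / 3) * y * (p - q / 3) ≤ (p + q) * (p - q / 3) := by
          have : (p + q / 3) * (y * (p - q / 3)) ≤ (p + q / 3) * p :=
            mul_le_mul_of_nonneg_left hc.le (by positivity)
          nlinarith
        exact le_of_mul_le_mul_right h6 h5
      nlinarith
  have h4 : p ^ 4 + q ^ 4 ≤ (p + q / 3) ^ 4 := by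
    have e1 : q ^ 4 ≤ p ^ 3 * q := by
      have : q ^ 3 ≤ p ^ 3 := pow_le_pow_left₀ hq.le hqp 3
      nlinarith
    have : 0 ≤ p ^ 2 * q ^ 2 := by positivity
    have : 0 ≤ p * q ^ 3 := by positivity
    have : 0 ≤ p ^ 3 * q := by positivity
    have : 0 ≤ q ^ 4 := by positivity
    nlinarith
  calc (p ^ 4 + q ^ 4) * r ^ 4 * (x * z) ^ 2
      ≤ (p + q / 3) ^ 4 * r ^ 4 * (x * z) ^ 2 := by gcongr
    _ = ((p + q / 3) * r * y) ^ 4 := by rw [← hy2]; ring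
    _ ≤ T ^ 4 := pow_le_pow_left₀ (by positivity) hT 4

omit [CommGroup G] in
theorem IsBinary.nonempty {v : ι → G → ℤ} {U : Finset G} (h : IsBinary v U) : U.Nonempty := by
  induction h with
  | singleton x => exact Finset.singleton_nonempty x
  | union i m n U V hne hU hV bU bV ihU ihV => exact ihU.mono Finset.subset_union_left

/-- The inequality of `IsBinary.card_mul_sq_le` passes from two fibres `U`, `V` to their union:
the contribution of the larger one suffices for spread-out `X`, `Y`, and the heaviest fibres of
`X` and `Y` produce disjoint products with `U` and with `V`. -/
theorem card_le_mul_mul_union (w : G → ℤ) (hw : ∀ x y, w (x * y) = w x + w y)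
    {U V : Finset G} {m n : ℤ} (hne : m ≠ n) (hU : ∀ x ∈ U, w x = m) (hV : ∀ x ∈ V, w x = n)
    (hU₀ : U.Nonempty) (hV₀ : V.Nonempty) (hVU : V.card ≤ U.card)
    (ihU : ∀ X Y : Finset G, X.Nonempty → Y.Nonempty →
      (U.card : ℝ) * X.card ^ 2 * Y.card ^ 2 ≤ ((X * Y * U).card : ℝ) ^ 4)
    (ihV : ∀ X Y : Finset G, X.Nonempty → Y.Nonempty →
      (V.card : ℝ) * X.card ^ 2 * Y.card ^ 2 ≤ ((X * Y * V).card : ℝ) ^ 4)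
    (X Y : Finset G) (hX : X.Nonempty) (hY : Y.Nonempty) :
    ((U ∪ V).card : ℝ) * X.card ^ 2 * Y.card ^ 2 ≤ ((X * Y * (U ∪ V)).card : ℝ) ^ 4 := by
  have hroot : ∀ {W : Finset G}, (∀ X Y : Finset G, X.Nonempty → Y.Nonempty →
      (W.card : ℝ) * X.card ^ 2 * Y.card ^ 2 ≤ ((X * Y * W).card : ℝ) ^ 4) →
      ∀ X Y : Finset G, X.Nonempty → Y.Nonempty →
      √√(W.card : ℝ) * √(X.card * Y.card) ≤ (X * Y * W).card := by
    intro W h X Y hX hY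
    refine le_of_pow_le_pow_left₀ (n := 4) (by norm_num) (by positivity) ?_
    refine le_trans (le_of_eq ?_) (h X Y hX hY)
    have e1 : √√(W.card : ℝ) ^ 4 = W.card := by
      rw [show 4 = 2 * 2 from rfl, pow_mul, Real.sq_sqrt (by positivity),
        Real.sq_sqrt (by positivity)]
    have e2 : √((X.card : ℝ) * Y.card) ^ 4 = (X.card * Y.card) ^ 2 := by
      rw [show 4 = 2 * 2 from rfl, pow_mul, Real.sq_sqrt (by positivity)]
    rw [mul_pow, e1, e2]; ring
  obtain ⟨i₀, hi₀, hM, hXmax⟩ := exists_max_fiber w hX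
  obtain ⟨j₀, hj₀, hN, hYmax⟩ := exists_max_fiber w hY
  have hfib : ∀ {Z : Finset G} {i : ℤ}, i ∈ Z.image w → (Z.filter (w · = i)).Nonempty := by
    intro Z i hi
    obtain ⟨x, hx, rfl⟩ := Finset.mem_image.1 hi
    exact ⟨x, by simp [hx]⟩
  have hUpos : (0 : ℝ) < U.card := by exact_mod_cast hU₀.card_pos
  have hVpos : (0 : ℝ) < V.card := by exact_mod_cast hV₀.card_pos
  have b1 := card_mul_mul_ge_of_fibers w hw X Y U m hU (√√(U.card : ℝ)) (by positivity) i₀ j₀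
    hi₀ hj₀ hM hN hXmax hYmax (fun i hi j hj => hroot ihU _ _ (hfib hi) (hfib hj))
  have b2 := hroot ihU _ _ (hfib hi₀) (hfib hj₀)
  have b3 := hroot ihV _ _ (hfib hi₀) (hfib hj₀)
  set X₀ := X.filter (w · = i₀)
  set Y₀ := Y.filter (w · = j₀)
  have hdis : Disjoint (X₀ * Y₀ * U) (X₀ * Y₀ * V) := by
    rw [Finset.disjoint_left]
    intro z hz hz'
    obtain ⟨xy, hxy, c, hc, rfl⟩ := Finset.mem_mul.1 hz
    obtain ⟨x, hx, y, hy, rfl⟩ := Finset.mem_mul.1 hxy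
    obtain ⟨xy', hxy', c', hc', he⟩ := Finset.mem_mul.1 hz'
    obtain ⟨x', hx', y', hy', rfl⟩ := Finset.mem_mul.1 hxy'
    have := congrArg w he
    simp only [hw, hU c hc, hV c' hc', (Finset.mem_filter.1 hx).2, (Finset.mem_filter.1 hx').2,
      (Finset.mem_filter.1 hy).2, (Finset.mem_filter.1 hy').2] at this
    omega
  have b4 : ((X₀ * Y₀ * U).card : ℝ) + (X₀ * Y₀ * V).card ≤ (X * Y * (U ∪ V)).card := by
    norm_cast
    rw [← Finset.card_union_of_disjoint hdis, ← Finset.mul_union]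
    exact Finset.card_le_card (Finset.mul_subset_mul_right (Finset.mul_subset_mul
      (Finset.filter_subset _ _) (Finset.filter_subset _ _)))
  have b5 : ((X * Y * U).card : ℝ) ≤ (X * Y * (U ∪ V)).card := by
    norm_cast
    exact Finset.card_le_card (Finset.mul_subset_mul_left Finset.subset_union_left)
  have hMr : (0 : ℝ) < X₀.card := by exact_mod_cast hM
  have hNr : (0 : ℝ) < Y₀.card := by exact_mod_cast hN
  have e0 : ∀ t : ℝ, 0 ≤ t → √√t ^ 4 = t := by
    intro t ht
    rw [show 4 = 2 * 2 from rfl, pow_mul, Real.sq_sqrt (by positivity), Real.sq_sqrt ht]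
  have := pow_four_add_le_of_two_bounds (p := √√(U.card : ℝ)) (q := √√(V.card : ℝ))
    (r := √(X₀.card * Y₀.card)) (x := X.card / X₀.card) (z := Y.card / Y₀.card)
    (T := (X * Y * (U ∪ V)).card) (by positivity) (by positivity)
    (Real.sqrt_le_sqrt (Real.sqrt_le_sqrt (by exact_mod_cast hVU))) (by positivity)
    ((one_le_div hMr).2 (by exact_mod_cast Finset.card_le_card (Finset.filter_subset _ _)))
    ((one_le_div hNr).2 (by exact_mod_cast Finset.card_le_card (Finset.filter_subset _ _)))
    (b1.trans b5) (by rw [add_mul]; linarith)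
  refine le_trans ?_ this
  rw [e0 _ hUpos.le, e0 _ hVpos.le]
  have e2 : √((X₀.card : ℝ) * Y₀.card) ^ 4 = (X₀.card * Y₀.card) ^ 2 := by
    rw [show 4 = 2 * 2 from rfl, pow_mul, Real.sq_sqrt (by positivity)]
  rw [e2]
  have e3 : ((U.card : ℝ) + V.card) * (X₀.card * Y₀.card) ^ 2 *
      (X.card / X₀.card * (Y.card / Y₀.card)) ^ 2 =
        (U.card + V.card) * X.card ^ 2 * Y.card ^ 2 := by
    field_simp
  rw [e3]
  gcongr
  exact_mod_cast Finset.card_union_le U V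

/-- Sumsets with a binary set `U` grow at least by a fixed power of `|U|`. -/
theorem IsBinary.card_mul_sq_le {v : ι → G → ℤ} (hv : ∀ i x y, v i (x * y) = v i x + v i y)
    {U : Finset G} (h : IsBinary v U) : ∀ X Y : Finset G, X.Nonempty → Y.Nonempty →
      (U.card : ℝ) * X.card ^ 2 * Y.card ^ 2 ≤ ((X * Y * U).card : ℝ) ^ 4 := by
  induction h with
  | singleton x =>
    intro X Y hX hY
    have h1 : (X.card : ℝ) ≤ (X * Y * {x}).card := by
      rw [Finset.card_mul_singleton]
      exact_mod_cast Finset.card_le_card_mul_right hY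
    have h2 : (Y.card : ℝ) ≤ (X * Y * {x}).card := by
      rw [Finset.card_mul_singleton]
      exact_mod_cast Finset.card_le_card_mul_left hX
    calc ((({x} : Finset G).card : ℕ) : ℝ) * X.card ^ 2 * Y.card ^ 2
        = (X.card : ℝ) ^ 2 * (Y.card : ℝ) ^ 2 := by simp
      _ ≤ ((X * Y * {x}).card : ℝ) ^ 2 * ((X * Y * {x}).card : ℝ) ^ 2 := by gcongr
      _ = _ := by ring
  | union i m n U V hne hU hV bU bV ihU ihV =>
    rcases le_total V.card U.card with h | h
    · exact card_le_mul_mul_union (v i) (hv i) hne hU hV bU.nonempty bV.nonempty h ihU ihV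
    · rw [Finset.union_comm]
      exact card_le_mul_mul_union (v i) (hv i) hne.symm hV hU bV.nonempty bU.nonempty h ihV ihU

theorem IsBinary.card_le_of_small_doubling {v : ι → G → ℤ}
    (hv : ∀ i x y, v i (x * y) = v i x + v i y) {U A : Finset G} (h : IsBinary v U) (hUA : U ⊆ A)
    {K : ℝ} (hA : ((A * A).card : ℝ) ≤ K * A.card) : (U.card : ℝ) ≤ K ^ 12 := by
  have hA₀ : A.Nonempty := h.nonempty.mono hUA
  have hpos : (0 : ℝ) < A.card := by exact_mod_cast hA₀.card_pos
  have h1 := h.card_mul_sq_le hv A A hA₀ hA₀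
  have h2 : ((A * A * U).card : ℝ) ≤ K ^ 3 * A.card := by
    have h3 : (A * A * U).card ≤ (A ^ 3).card := by
      refine Finset.card_le_card ?_
      rw [pow_succ, sq]
      exact Finset.mul_subset_mul_left hUA
    have h4 := Finset.pluennecke_ruzsa_inequality_pow_mul hA₀ A 3
    have h5 : ((A ^ 3).card : ℝ) ≤ ((A * A).card / A.card : ℝ) ^ 3 * A.card := by
      have := (NNRat.cast_le (K := ℝ)).2 h4
      push_cast at this
      exact this
    calc ((A * A * U).card : ℝ) ≤ (A ^ 3).card := by exact_mod_cast h3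
      _ ≤ _ := h5
      _ ≤ K ^ 3 * A.card := by
        gcongr
        rw [div_le_iff₀ hpos]
        exact hA
  have h6 : (U.card : ℝ) * A.card ^ 4 ≤ K ^ 12 * A.card ^ 4 := by
    calc (U.card : ℝ) * A.card ^ 4 = U.card * A.card ^ 2 * A.card ^ 2 := by ring
      _ ≤ ((A * A * U).card : ℝ) ^ 4 := h1
      _ ≤ (K ^ 3 * A.card) ^ 4 := by gcongr
      _ = _ := by ring
  exact le_of_mul_le_mul_right h6 (by positivity)

end Quasicube

/-! ### Energies and the group algebra -/

/-- The ratios `a (i + 1) / a i` increase, so the first is at most the geometric mean of all. -/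
theorem pow_le_of_log_convex {a : ℕ → ℝ} {k : ℕ} (h₀ : ∀ i, 0 ≤ a i)
    (h : ∀ i, i + 2 ≤ k → a (i + 1) ^ 2 ≤ a i * a (i + 2)) (hk : 1 ≤ k) :
    a 1 ^ k ≤ a 0 ^ (k - 1) * a k := by
  rcases (h₀ 1).eq_or_lt with h1 | h1
  · rw [← h1, zero_pow (by omega)]
    exact mul_nonneg (pow_nonneg (h₀ 0) _) (h₀ k)
  have step : ∀ m, m + 2 ≤ k → 0 < a (m + 1) ∧ a 1 * a (m + 1) ≤ a 0 * a (m + 2) := by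
    intro m
    induction m with
    | zero =>
      intro hm
      exact ⟨h1, by have := h 0 hm; simpa [sq] using this⟩
    | succ m ih =>
      intro hm
      obtain ⟨hp, hle⟩ := ih (by omega)
      have hc := h (m + 1) hm
      have hp' : 0 < a (m + 2) := by
        by_contra hcon
        have h0 : a (m + 2) = 0 := le_antisymm (not_lt.1 hcon) (h₀ _)
        rw [h0, mul_zero] at hle
        exact absurd hle (not_le.2 (mul_pos h1 hp))
      refine ⟨hp', ?_⟩
      have h3 : a 1 * a (m + 2) * a (m + 1) ≤ a 0 * a (m + 3) * a (m + 1) := by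
        calc a 1 * a (m + 2) * a (m + 1) = a 1 * a (m + 1) * a (m + 2) := by ring
          _ ≤ a 0 * a (m + 2) * a (m + 2) := by gcongr
          _ = a 0 * a (m + 1 + 1) ^ 2 := by ring
          _ ≤ a 0 * (a (m + 1) * a (m + 1 + 2)) := mul_le_mul_of_nonneg_left hc (h₀ 0)
          _ = _ := by ring
      exact le_of_mul_le_mul_right h3 hp
  have main : ∀ m, m + 1 ≤ k → a 1 ^ (m + 1) ≤ a 0 ^ m * a (m + 1) := by
    intro m
    induction m with
    | zero => intro _; simp
    | succ m ih =>
      intro hm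
      have h2 := (step m hm).2
      calc a 1 ^ (m + 1 + 1) = a 1 * a 1 ^ (m + 1) := by ring
        _ ≤ a 1 * (a 0 ^ m * a (m + 1)) := by have := ih (by omega); gcongr
        _ = a 0 ^ m * (a 1 * a (m + 1)) := by ring
        _ ≤ a 0 ^ m * (a 0 * a (m + 2)) := by
          have := h₀ 0
          gcongr
        _ = _ := by ring
  obtain ⟨m, rfl⟩ := Nat.exists_eq_add_of_le' hk
  simpa using main m le_rfl

namespace MonoidAlgebra

variable {H : Type*} [CommGroup H]

/-- The ring endomorphism of the real group algebra that inverts the group elements. -/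
noncomputable def invHom (H : Type*) [CommGroup H] : MonoidAlgebra ℝ H →+* MonoidAlgebra ℝ H :=
  mapDomainRingHom ℝ (invMonoidHom : H →* H)

theorem invHom_single (h : H) (r : ℝ) : invHom H (single h r) = single h⁻¹ r := by
  simp [invHom]

theorem invHom_invHom (u : MonoidAlgebra ℝ H) : invHom H (invHom H u) = u := by
  have : (invHom H).comp (invHom H) = RingHom.id _ := by
    refine MonoidAlgebra.ringHom_ext ?_ ?_ <;> intro r <;> simp [invHom_single]
  exact DFunLike.congr_fun this u

theorem coeff_one_mul_invHom [DecidableEq H] (u v : MonoidAlgebra ℝ H) :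
    (u * invHom H v).coeff 1 = ∑ h ∈ u.coeff.support ∪ v.coeff.support, u.coeff h * v.coeff h := by
  have h1 : ∀ h, (invHom H v).coeff h⁻¹ = v.coeff h := by
    intro h
    simp only [invHom, mapDomainRingHom_apply]
    exact Finsupp.mapDomain_apply inv_injective v.coeff h
  rw [coeff_mul_apply_left, Finsupp.sum_of_support_subset _ Finset.subset_union_left]
  · refine Finset.sum_congr rfl fun h _ => ?_
    rw [mul_one, h1]
  · simp

theorem coeff_one_mul_invHom_self_nonneg (u : MonoidAlgebra ℝ H) :
    0 ≤ (u * invHom H u).coeff 1 := by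
  classical
  rw [coeff_one_mul_invHom]
  exact Finset.sum_nonneg fun h _ => mul_self_nonneg _

/-- The Cauchy–Schwarz inequality for the form `(u, v) ↦ ∑ h, u h * v h` on the group algebra. -/
theorem sq_coeff_one_mul_invHom_le (u v : MonoidAlgebra ℝ H) :
    ((u * invHom H v).coeff 1) ^ 2 ≤
      (u * invHom H u).coeff 1 * (v * invHom H v).coeff 1 := by
  classical
  have h : ∀ w : MonoidAlgebra ℝ H, ∀ s : Finset H, w.coeff.support ⊆ s →
      (w * invHom H w).coeff 1 = ∑ h ∈ s, w.coeff h ^ 2 := by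
    intro w s hs
    rw [coeff_one_mul_invHom, Finset.union_self]
    simp_rw [← sq]
    refine Finset.sum_subset hs fun x _ hx => ?_
    rw [Finsupp.notMem_support_iff.1 hx]; simp
  rw [h u _ Finset.subset_union_left, h v _ Finset.subset_union_right, coeff_one_mul_invHom]
  exact Finset.sum_mul_sq_le_sq_mul_sq _ _ _

/-- If `‖f‖` denotes the `2k`-norm on the dual group, this says
`∫ |f|² |g|^(2k-2) ≤ ‖f‖² ‖g‖^(2k-2)`, raised to the power `k`. -/
theorem coeff_one_pow_le (f g : MonoidAlgebra ℝ H) {k : ℕ} (hk : 1 ≤ k) :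
    ((f * invHom H f * (g * invHom H g) ^ (k - 1)).coeff 1) ^ k ≤
      ((g * invHom H g) ^ k).coeff 1 ^ (k - 1) * ((f * invHom H f) ^ k).coeff 1 := by
  have key := pow_le_of_log_convex
    (a := fun i => ((f * invHom H f) ^ i * (g * invHom H g) ^ (k - i)).coeff 1) (k := k)
    (fun i => by
      have := coeff_one_mul_invHom_self_nonneg (f ^ i * g ^ (k - i))
      convert this using 2
      refine congrArg MonoidAlgebra.coeff ?_
      simp only [map_mul, map_pow]; ring)
    (fun i hi => by
      -- The middle term is a product of two words whose lengths in `f` differ by two.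
      obtain ⟨m, rfl⟩ : ∃ m, k = i + 2 + m := ⟨k - (i + 2), by omega⟩
      have := sq_coeff_one_mul_invHom_le (invHom H f ^ i * g ^ (m + 1) * invHom H g)
        (invHom H f ^ (i + 1) * f * g ^ m)
      rw [show i + 2 + m - (i + 1) = m + 1 by omega, show i + 2 + m - i = m + 2 by omega,
        show i + 2 + m - (i + 2) = m by omega]
      simp only [map_mul, map_pow, invHom_invHom] at this
      convert this using 3
      · refine congrArg MonoidAlgebra.coeff ?_
        ring
      · refine congrArg MonoidAlgebra.coeff ?_
        ring
      · refine congrArg MonoidAlgebra.coeff ?_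
        ring) hk
  simpa using key

/-- Among the words with two letters `f`, distributed over the two sides of an equation with `k`
letters on each side, those with one `f` on each side have the largest coefficient at `1`. -/
theorem coeff_one_word_le (f g : MonoidAlgebra ℝ H) {k a c : ℕ} (hk : 2 ≤ k) (hac : a + c = 2) :
    (f ^ a * g ^ (k - a) * invHom H (f ^ c * g ^ (k - c))).coeff 1 ≤
      (f * invHom H f * (g * invHom H g) ^ (k - 1)).coeff 1 := by
  obtain ⟨m, rfl⟩ : ∃ m, k = m + 2 := ⟨k - 2, by omega⟩
  have hX : 0 ≤ (f * invHom H f * (g * invHom H g) ^ (m + 2 - 1)).coeff 1 := by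
    have := coeff_one_mul_invHom_self_nonneg (f * g ^ (m + 1))
    convert this using 2
    refine congrArg MonoidAlgebra.coeff ?_
    simp only [map_mul, map_pow, Nat.add_succ_sub_one]; ring
  have h : (a = 1 ∧ c = 1) ∨ (a = 2 ∧ c = 0) ∨ (a = 0 ∧ c = 2) := by omega
  rcases h with ⟨rfl, rfl⟩ | ⟨rfl, rfl⟩ | ⟨rfl, rfl⟩
  · refine le_of_eq (congrArg (fun x : MonoidAlgebra ℝ H => x.coeff 1) ?_)
    simp only [map_mul, map_pow, Nat.add_succ_sub_one]; ring
  · have e₀ : f ^ 2 * g ^ (m + 2 - 2) * invHom H (f ^ 0 * g ^ (m + 2 - 0)) =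
        (f * invHom H g ^ (m + 1)) * invHom H ((invHom H f * g * invHom H g ^ m)) := by
      simp only [map_mul, map_pow, invHom_invHom, Nat.add_sub_cancel, Nat.sub_zero]; ring
    have e₁ : f * invHom H f * (g * invHom H g) ^ (m + 2 - 1) =
        (f * invHom H g ^ (m + 1)) * invHom H ((f * invHom H g ^ (m + 1))) := by
      rw [show m + 2 - 1 = m + 1 from rfl]
      simp only [map_mul, map_pow, invHom_invHom]; ring
    have e₂ : f * invHom H f * (g * invHom H g) ^ (m + 2 - 1) =
        (invHom H f * g * invHom H g ^ m) * invHom H ((invHom H f * g * invHom H g ^ m)) := by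
      rw [show m + 2 - 1 = m + 1 from rfl]
      simp only [map_mul, map_pow, invHom_invHom]; ring
    refine abs_le_of_sq_le_sq' ?_ hX |>.2
    rw [e₀, sq ((f * invHom H f * _).coeff 1)]
    nth_rw 1 [e₁]
    rw [e₂]
    exact sq_coeff_one_mul_invHom_le _ _
  · have e₀ : f ^ 0 * g ^ (m + 2 - 0) * invHom H (f ^ 2 * g ^ (m + 2 - 2)) =
        (invHom H f * g ^ (m + 1)) * invHom H ((f * invHom H g * g ^ m)) := by
      simp only [map_mul, map_pow, invHom_invHom, Nat.add_sub_cancel, Nat.sub_zero]; ring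
    have e₁ : f * invHom H f * (g * invHom H g) ^ (m + 2 - 1) =
        (invHom H f * g ^ (m + 1)) * invHom H ((invHom H f * g ^ (m + 1))) := by
      rw [show m + 2 - 1 = m + 1 from rfl]
      simp only [map_mul, map_pow, invHom_invHom]; ring
    have e₂ : f * invHom H f * (g * invHom H g) ^ (m + 2 - 1) =
        (f * invHom H g * g ^ m) * invHom H ((f * invHom H g * g ^ m)) := by
      rw [show m + 2 - 1 = m + 1 from rfl]
      simp only [map_mul, map_pow, invHom_invHom]; ring
    refine abs_le_of_sq_le_sq' ?_ hX |>.2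
    rw [e₀, sq ((f * invHom H f * _).coeff 1)]
    nth_rw 1 [e₁]
    rw [e₂]
    exact sq_coeff_one_mul_invHom_le _ _

end MonoidAlgebra

section Energy

open MonoidAlgebra

variable {α H : Type*} [CommGroup H] [DecidableEq H]

/-- The number of solutions of `g x₁ ⋯ g x_k = g y₁ ⋯ g y_k` with `x_i ∈ X i` and `y_i ∈ Y i`. -/
def solutionCount (g : α → H) {k : ℕ} (X Y : Fin k → Finset α) : ℕ :=
  ((Fintype.piFinset X ×ˢ Fintype.piFinset Y).filter
    fun z => ∏ i, g (z.1 i) = ∏ i, g (z.2 i)).card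

/-- The multiplicative `k`-energy of the family `g`, restricted to `S`. -/
def energy (g : α → H) (k : ℕ) (S : Finset α) : ℕ :=
  solutionCount g (fun _ : Fin k => S) (fun _ => S)

/-- The element of the group algebra that represents the family `g`, restricted to `S`. -/
noncomputable def toAlgebra (g : α → H) (S : Finset α) : MonoidAlgebra ℝ H :=
  ∑ s ∈ S, single (g s) 1

omit [DecidableEq H] in
theorem prod_toAlgebra [DecidableEq α] (g : α → H) {k : ℕ} (X : Fin k → Finset α) :
    ∏ i, toAlgebra g (X i) = ∑ x ∈ Fintype.piFinset X, single (∏ i, g (x i)) (1 : ℝ) := by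
  unfold toAlgebra
  rw [Finset.prod_univ_sum]
  refine Finset.sum_congr rfl fun x _ => ?_
  simp

theorem solutionCount_eq_coeff [DecidableEq α] (g : α → H) {k : ℕ} (X Y : Fin k → Finset α) :
    (solutionCount g X Y : ℝ) =
      ((∏ i, toAlgebra g (X i)) * invHom H (∏ i, toAlgebra g (Y i))).coeff 1 := by
  rw [prod_toAlgebra, prod_toAlgebra, map_sum, Finset.sum_mul_sum, coeff_sum, solutionCount,
    Finset.card_filter, Finset.sum_product]
  push_cast
  rw [Finset.sum_apply]
  refine Finset.sum_congr rfl fun x _ => ?_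
  rw [coeff_sum, Finsupp.coe_finsetSum, Finset.sum_apply]
  refine Finset.sum_congr rfl fun y _ => ?_
  rw [invHom_single, single_mul_single, coeff_single, Finsupp.single_apply]
  simp [mul_inv_eq_one]

theorem energy_eq_coeff [DecidableEq α] (g : α → H) (k : ℕ) (S : Finset α) :
    (energy g k S : ℝ) = ((toAlgebra g S * invHom H (toAlgebra g S)) ^ k).coeff 1 := by
  rw [energy, solutionCount_eq_coeff]
  simp [mul_pow]

omit [DecidableEq H] in
theorem prod_toAlgebra_ite (g : α → H) {k : ℕ} (I : Finset (Fin k)) (T S : Finset α) :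
    ∏ i, toAlgebra g (if i ∈ I then T else S) =
      toAlgebra g T ^ I.card * toAlgebra g S ^ (k - I.card) := by
  have : ∀ i, toAlgebra g (if i ∈ I then T else S) =
      if i ∈ I then toAlgebra g T else toAlgebra g S := by
    intro i; split_ifs <;> rfl
  simp_rw [this]
  rw [Finset.prod_ite, Finset.prod_const, Finset.prod_const]
  congr 2
  · simp
  · rw [Finset.filter_not, Finset.card_sdiff_of_subset (Finset.filter_subset _ _)]
    simp

/-- Restricting two of the `2k` variables to `T` costs the factor `(energy T / energy S) ^ (1 / k)`
that Hölder's inequality on the dual group predicts. -/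
theorem solutionCount_ite_pow_le [DecidableEq α] (g : α → H) {k : ℕ} (hk : 2 ≤ k)
    (I J : Finset (Fin k)) (hIJ : I.card + J.card = 2) (T S : Finset α) :
    (solutionCount g (fun i => if i ∈ I then T else S) (fun i => if i ∈ J then T else S) : ℝ) ^ k
      ≤ (energy g k S : ℝ) ^ (k - 1) * energy g k T := by
  rw [solutionCount_eq_coeff, prod_toAlgebra_ite, prod_toAlgebra_ite, energy_eq_coeff,
    energy_eq_coeff]
  refine le_trans (pow_le_pow_left₀ ?_ (coeff_one_word_le _ _ hk hIJ) k)
    (coeff_one_pow_le _ _ (by omega))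
  rw [← prod_toAlgebra_ite, ← prod_toAlgebra_ite, ← solutionCount_eq_coeff]
  positivity

/-- If every solution has two entries with the same value of `w`, the `2k`-norm is almost
orthogonal with respect to the fibres of `w`. -/
theorem energy_le_of_collision [DecidableEq α] (g : α → H) {k : ℕ} (hk : 2 ≤ k) (w : α → ℤ)
    (S : Finset α)
    (hcol : ∀ x y : Fin k → α, (∀ i, x i ∈ S) → (∀ i, y i ∈ S) → ∏ i, g (x i) = ∏ i, g (y i) →
      ∃ u v : Fin k ⊕ Fin k, u ≠ v ∧ w (Sum.elim x y u) = w (Sum.elim x y v))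
    {c : ℝ} (hc : 0 ≤ c)
    (h : ∀ j, (energy g k (S.filter (w · = j)) : ℝ) ≤ (c * (S.filter (w · = j)).card) ^ k) :
    (energy g k S : ℝ) ≤ (4 * k ^ 2 * c * S.card) ^ k := by
  set E : ℝ := (energy g k S : ℝ) with hE
  have hE0 : 0 ≤ E := by positivity
  have hk0 : k ≠ 0 := by omega
  obtain ⟨e, he0, he⟩ : ∃ e : ℝ, 0 ≤ e ∧ e ^ k = E :=
    ⟨E ^ ((k : ℝ)⁻¹), by positivity, Real.rpow_inv_natCast_pow hE0 hk0⟩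
  -- `N u v j` counts the solutions whose entries at `u` and `v` lie in the fibre over `j`.
  let N : Fin k ⊕ Fin k → Fin k ⊕ Fin k → ℤ → ℕ := fun u v j =>
    solutionCount g (fun i => if i ∈ Finset.univ.filter (fun i => Sum.inl i = u ∨ Sum.inl i = v)
        then S.filter (w · = j) else S)
      (fun i => if i ∈ Finset.univ.filter (fun i => Sum.inr i = u ∨ Sum.inr i = v)
        then S.filter (w · = j) else S)
  have hN : ∀ u v j, u ≠ v → (N u v j : ℝ) ≤ e ^ (k - 1) * (c * (S.filter (w · = j)).card) := by
    intro u v j huv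
    have hcard : (Finset.univ.filter (fun i : Fin k => Sum.inl i = u ∨ Sum.inl i = v)).card +
        (Finset.univ.filter (fun i : Fin k => Sum.inr i = u ∨ Sum.inr i = v)).card = 2 := by
      have h1 : (({u, v} : Finset (Fin k ⊕ Fin k))).card = 2 := Finset.card_pair huv
      rw [← h1, ← Finset.card_map ⟨Sum.inl, Sum.inl_injective⟩ (β := Fin k ⊕ Fin k),
        ← Finset.card_map ⟨Sum.inr, Sum.inr_injective⟩ (β := Fin k ⊕ Fin k),
        ← Finset.card_union_of_disjoint]
      · congr 1
        ext z
        rcases z with z | z <;> simp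
      · rw [Finset.disjoint_left]
        intro z hz hz'
        simp only [Finset.mem_map, Function.Embedding.coeFn_mk] at hz hz'
        obtain ⟨a, -, rfl⟩ := hz
        obtain ⟨b, -, hb⟩ := hz'
        cases hb
    have h1 := solutionCount_ite_pow_le g hk _ _ hcard (S.filter (w · = j)) S
    refine le_of_pow_le_pow_left₀ hk0 (by positivity) (h1.trans ?_)
    rw [mul_pow, ← pow_mul, mul_comm (k - 1) k, pow_mul, he]
    exact mul_le_mul_of_nonneg_left (h j) (by positivity)
  have hcount : energy g k S ≤
      ∑ p ∈ (Finset.univ : Finset ((Fin k ⊕ Fin k) × (Fin k ⊕ Fin k))).filter (fun p => p.1 ≠ p.2),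
        ∑ j ∈ S.image w, N p.1 p.2 j := by
    rw [← Finset.sum_product', energy, solutionCount]
    refine le_trans (Finset.card_le_card ?_) Finset.card_biUnion_le
    intro z hz
    rw [Finset.mem_filter, Finset.mem_product, Fintype.mem_piFinset, Fintype.mem_piFinset] at hz
    obtain ⟨⟨hx, hy⟩, hz⟩ := hz
    obtain ⟨u, v, huv, hw⟩ := hcol z.1 z.2 hx hy hz
    have hmem : ∀ u, Sum.elim z.1 z.2 u ∈ S := by rintro (i | i) <;> simp [hx, hy]
    refine Finset.mem_biUnion.2 ⟨((u, v), w (Sum.elim z.1 z.2 u)), ?_, ?_⟩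
    · simp only [Finset.mem_product, Finset.mem_filter, Finset.mem_univ, true_and]
      exact ⟨huv, Finset.mem_image_of_mem w (hmem u)⟩
    · simp only [Finset.mem_filter, Finset.mem_product, Fintype.mem_piFinset]
      refine ⟨⟨fun i => ?_, fun i => ?_⟩, hz⟩
      · split_ifs with hi
        · rw [Finset.mem_filter]
          refine ⟨hx i, ?_⟩
          rcases hi.2 with h | h
          · rw [← h]; rfl
          · rw [hw, ← h]; rfl
        · exact hx i
      · split_ifs with hi
        · rw [Finset.mem_filter]
          refine ⟨hy i, ?_⟩
          rcases hi.2 with h | h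
          · rw [← h]; rfl
          · rw [hw, ← h]; rfl
        · exact hy i
  have hsum : ∑ j ∈ S.image w, ((S.filter (w · = j)).card : ℝ) = S.card := by
    rw [Finset.card_eq_sum_card_image w S]
    push_cast
    rfl
  have hfinal : E ≤ 4 * k ^ 2 * (e ^ (k - 1) * (c * S.card)) := by
    calc E ≤ ∑ p ∈ (Finset.univ : Finset ((Fin k ⊕ Fin k) × (Fin k ⊕ Fin k))).filter
            (fun p => p.1 ≠ p.2), ∑ j ∈ S.image w, (N p.1 p.2 j : ℝ) := by
          rw [hE]; exact_mod_cast hcount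
      _ ≤ ∑ p ∈ (Finset.univ : Finset ((Fin k ⊕ Fin k) × (Fin k ⊕ Fin k))).filter
            (fun p => p.1 ≠ p.2), e ^ (k - 1) * (c * S.card) := by
          refine Finset.sum_le_sum fun p hp => ?_
          rw [← hsum, Finset.mul_sum, Finset.mul_sum]
          exact Finset.sum_le_sum fun j _ => hN _ _ _ (Finset.mem_filter.1 hp).2
      _ ≤ 4 * k ^ 2 * (e ^ (k - 1) * (c * S.card)) := by
          rw [Finset.sum_const, nsmul_eq_mul]
          refine mul_le_mul_of_nonneg_right ?_ (by positivity)
          have : ((Finset.univ : Finset ((Fin k ⊕ Fin k) × (Fin k ⊕ Fin k))).filter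
            (fun p => p.1 ≠ p.2)).card ≤ 4 * k ^ 2 := by
            refine (Finset.card_le_univ _).trans (le_of_eq ?_)
            simp; ring
          exact_mod_cast this
  rw [← he]
  refine pow_le_pow_left₀ he0 ?_ k
  rcases he0.eq_or_lt with h0 | h0
  · rw [← h0]; positivity
  have hek : e * e ^ (k - 1) = E := by rw [← he, ← pow_succ']; congr 1; omega
  have hpos : 0 < e ^ (k - 1) := by positivity
  refine le_of_mul_le_mul_right ?_ hpos
  rw [hek]
  linarith

end Energy

/-! ### Decision depth -/

section DecisionTree

variable {α ι : Type*}

/-- `HasDepth v r A`: an adaptive sequence of at most `r` queries to the coordinates `v i`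
identifies every element of `A`. -/
def HasDepth (v : ι → α → ℤ) : ℕ → Finset α → Prop
  | 0, A => A.card ≤ 1
  | r + 1, A => A.card ≤ 1 ∨ ∃ i, ∀ n, HasDepth v r (A.filter (v i · = n))

theorem HasDepth.subset {v : ι → α → ℤ} {r : ℕ} : ∀ {A B : Finset α}, HasDepth v r A → B ⊆ A →
    HasDepth v r B := by
  induction r with
  | zero => exact fun h hB => (Finset.card_le_card hB).trans h
  | succ r ih =>
    rintro A B (h | ⟨i, h⟩) hB
    · exact Or.inl ((Finset.card_le_card hB).trans h)
    · exact Or.inr ⟨i, fun n => ih (h n) (Finset.filter_subset_filter _ hB)⟩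

theorem HasDepth.of_card_le_one {v : ι → α → ℤ} {r : ℕ} {A : Finset α} (h : A.card ≤ 1) :
    HasDepth v r A := by
  cases r with
  | zero => exact h
  | succ r => exact Or.inl h

theorem HasDepth.mono {v : ι → α → ℤ} {r s : ℕ} (hrs : r ≤ s) {A : Finset α}
    (h : HasDepth v r A) : HasDepth v s A := by
  induction s generalizing r A with
  | zero => obtain rfl : r = 0 := by omega
            exact h
  | succ s ih =>
    cases r with
    | zero => exact Or.inl h
    | succ r =>
      rcases h with h | ⟨i, h⟩
      · exact Or.inl h
      · exact Or.inr ⟨i, fun n => ih (by omega) (h n)⟩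

variable [DecidableEq α]

/-- Every finite set has a large subset of small decision depth, unless it contains a large
binary set. At a node, either the fibre with the largest binary subset is kept alone, or it is
discarded and the coordinate is queried on the others; a binary subset of the largest fibre
and one of the second largest together form a binary set, which pays for both options. -/
theorem exists_hasDepth_subset (v : ι → α → ℤ) (L : ℕ) (A : Finset α) (hA : A.Nonempty)
    (hL : ∀ T ⊆ A, (∀ i, ∀ x ∈ T, ∀ y ∈ T, v i x = v i y) → T.card ≤ L) :
    ∃ U ⊆ A, IsBinary v U ∧ ∃ B ⊆ A, ∃ r, HasDepth v r B ∧ 2 ^ r ≤ U.card ∧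
      A.card ≤ L * B.card * U.card := by
  induction A using Finset.strongInduction with
  | H A ih =>
  by_cases hconst : ∀ i, ∀ x ∈ A, ∀ y ∈ A, v i x = v i y
  · obtain ⟨x, hx⟩ := hA
    refine ⟨{x}, by simpa using hx, .singleton x, {x}, by simpa using hx, 0, ?_, by simp, ?_⟩
    · simp [HasDepth]
    · simpa using hL A subset_rfl hconst
  push Not at hconst
  obtain ⟨i, x, hx, y, hy, hxy⟩ := hconst
  have hfib : ∀ n ∈ A.image (v i), ∃ U ⊆ A.filter (v i · = n), IsBinary v U ∧
      ∃ B ⊆ A.filter (v i · = n), ∃ r, HasDepth v r B ∧ 2 ^ r ≤ U.card ∧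
      (A.filter (v i · = n)).card ≤ L * B.card * U.card := by
    intro n hn
    refine ih _ ?_ ?_ (fun T hT => hL T (hT.trans (Finset.filter_subset _ _)))
    · refine Finset.filter_ssubset.2 ?_
      by_contra hcon
      push Not at hcon
      exact hxy ((hcon x hx).trans (hcon y hy).symm)
    · obtain ⟨z, hz, rfl⟩ := Finset.mem_image.1 hn
      exact ⟨z, by simp [hz]⟩
  choose! U hUA hU B hBA r hB hr hcard using hfib
  obtain ⟨n₀, hn₀, hmax₀⟩ := Finset.exists_max_image (A.image (v i)) (fun n => (U n).card)
    ⟨_, Finset.mem_image_of_mem _ hx⟩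
  have herase : ((A.image (v i)).erase n₀).Nonempty := by
    by_cases h : v i x = n₀
    · exact ⟨v i y, Finset.mem_erase.2 ⟨fun h' => hxy (h.trans h'.symm),
        Finset.mem_image_of_mem _ hy⟩⟩
    · exact ⟨v i x, Finset.mem_erase.2 ⟨h, Finset.mem_image_of_mem _ hx⟩⟩
  obtain ⟨n₁, hn₁, hmax₁⟩ := Finset.exists_max_image _ (fun n => (U n).card) herase
  have hn₁' := Finset.mem_of_mem_erase hn₁
  have hne : n₀ ≠ n₁ := (Finset.ne_of_mem_erase hn₁).symm
  have hval : ∀ n ∈ A.image (v i), ∀ z ∈ U n, v i z = n := fun n hn z hz =>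
    (Finset.mem_filter.1 (hUA n hn hz)).2
  have hdis : Disjoint (U n₀) (U n₁) := by
    rw [Finset.disjoint_left]
    intro z hz hz'
    exact hne ((hval _ hn₀ z hz).symm.trans (hval _ hn₁' z hz'))
  have hUcard : (U n₀ ∪ U n₁).card = (U n₀).card + (U n₁).card :=
    Finset.card_union_of_disjoint hdis
  refine ⟨U n₀ ∪ U n₁, ?_, .union i n₀ n₁ _ _ hne (hval _ hn₀) (hval _ hn₁') (hU _ hn₀)
    (hU _ hn₁'), ?_⟩
  · exact Finset.union_subset ((hUA _ hn₀).trans (Finset.filter_subset _ _))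
      ((hUA _ hn₁').trans (Finset.filter_subset _ _))
  set E := (A.image (v i)).erase n₀
  have hEA : ∀ n ∈ E, n ∈ A.image (v i) := fun n hn => Finset.mem_of_mem_erase hn
  have hBval : ∀ n ∈ A.image (v i), ∀ z ∈ B n, v i z = n := fun n hn z hz =>
    (Finset.mem_filter.1 (hBA n hn hz)).2
  set B₁ := E.biUnion B
  have hB₁card : B₁.card = ∑ n ∈ E, (B n).card := by
    refine Finset.card_biUnion fun m hm n hn hmn => ?_
    refine Finset.disjoint_left.2 ?_
    intro z hz hz'
    exact hmn ((hBval _ (hEA _ hm) z hz).symm.trans (hBval _ (hEA _ hn) z hz'))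
  have hAcard : A.card ≤ L * (B n₀).card * (U n₀).card + L * B₁.card * (U n₁).card := by
    rw [Finset.card_eq_sum_card_image (v i) A, ← Finset.add_sum_erase _ _ hn₀, hB₁card,
      Finset.mul_sum, Finset.sum_mul]
    refine add_le_add (hcard _ hn₀) (Finset.sum_le_sum fun n hn => (hcard n (hEA n hn)).trans ?_)
    exact Nat.mul_le_mul_left _ (hmax₁ n hn)
  have hB₁depth : HasDepth v (Nat.log 2 (U n₁).card + 1) B₁ := by
    refine Or.inr ⟨i, fun n => ?_⟩
    by_cases hn : n ∈ E
    · refine (((hB n (hEA n hn)).mono ?_).subset (B := B₁.filter (v i · = n)) ?_)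
      · exact Nat.le_log_of_pow_le (by norm_num) ((hr n (hEA n hn)).trans (hmax₁ n hn))
      · intro z hz
        obtain ⟨hz₁, hzn⟩ := Finset.mem_filter.1 hz
        obtain ⟨m, hm, hzm⟩ := Finset.mem_biUnion.1 hz₁
        obtain rfl : m = n := (hBval m (hEA m hm) z hzm).symm.trans hzn
        exact hzm
    · refine HasDepth.of_card_le_one ?_
      rw [Finset.filter_eq_empty_iff.2]
      · simp
      · intro z hz hzn
        obtain ⟨m, hm, hz⟩ := Finset.mem_biUnion.1 hz
        obtain rfl : m = n := (hBval m (hEA m hm) z hz).symm.trans hzn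
        exact hn hm
  rcases le_total B₁.card (B n₀).card with hle | hle
  · refine ⟨B n₀, (hBA _ hn₀).trans (Finset.filter_subset _ _), r n₀, hB _ hn₀, ?_, ?_⟩
    · rw [hUcard]; exact (hr _ hn₀).trans (Nat.le_add_right _ _)
    · calc A.card ≤ _ := hAcard
        _ ≤ L * (B n₀).card * (U n₀).card + L * (B n₀).card * (U n₁).card := by gcongr
        _ = _ := by rw [hUcard]; ring
  · refine ⟨B₁, ?_, _, hB₁depth, ?_, ?_⟩
    · exact Finset.biUnion_subset.2 fun n hn => (hBA n (hEA n hn)).trans (Finset.filter_subset _ _)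
    · have h1 : 2 ^ Nat.log 2 (U n₁).card ≤ (U n₁).card :=
        Nat.pow_log_le_self 2 (hU _ hn₁').nonempty.card_pos.ne'
      have h2 := hmax₀ _ hn₁'
      rw [hUcard, pow_succ]
      omega
    · calc A.card ≤ _ := hAcard
        _ ≤ L * B₁.card * (U n₀).card + L * B₁.card * (U n₁).card := by gcongr
        _ = _ := by rw [hUcard]; ring

omit [DecidableEq α] in
theorem energy_le_of_card_le_one {H : Type*} [CommGroup H] [DecidableEq H] (g : α → H) {k : ℕ}
    {S : Finset α} (hS : S.card ≤ 1) : energy g k S ≤ S.card ^ k := by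
  calc energy g k S ≤ S.card ^ k * S.card ^ k := by
        refine (Finset.card_filter_le _ _).trans (le_of_eq ?_)
        simp
    _ ≤ S.card ^ k * 1 := by gcongr; exact pow_le_one₀ (by omega) hS
    _ = _ := mul_one _

/-- A set of small decision depth has a large subset of nearly minimal energy, provided the values
of each coordinate fall into boundedly many classes such that a solution with all entries in
one class has two entries in one fibre. -/
theorem exists_subset_energy_le {H κ : Type*} [CommGroup H] [DecidableEq H] [Fintype κ]
    [DecidableEq κ] [Nonempty κ] (g : α → H) {k : ℕ} (hk : 2 ≤ k) (v : ι → α → ℤ)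
    (cl : ι → ℤ → κ) (P : α → Prop)
    (hcol : ∀ i, ∀ x y : Fin k → α, (∀ t, P (x t)) → (∀ t, P (y t)) →
      (∀ t u : Fin k ⊕ Fin k, cl i (v i (Sum.elim x y t)) = cl i (v i (Sum.elim x y u))) →
      ∏ t, g (x t) = ∏ t, g (y t) →
      ∃ t u : Fin k ⊕ Fin k, t ≠ u ∧ v i (Sum.elim x y t) = v i (Sum.elim x y u))
    (r : ℕ) : ∀ S : Finset α, (∀ s ∈ S, P s) → HasDepth v r S →
      ∃ T ⊆ S, S.card ≤ Fintype.card κ ^ r * T.card ∧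
        (energy g k T : ℝ) ≤ ((4 * k ^ 2) ^ r * T.card) ^ k := by
  have hD : 1 ≤ Fintype.card κ := Fintype.card_pos
  have hk1 : (1 : ℝ) ≤ 4 * (k : ℝ) ^ 2 := by
    have : (2 : ℝ) ≤ k := by exact_mod_cast hk
    nlinarith
  have hsmall : ∀ (r : ℕ) (S : Finset α), S.card ≤ 1 →
      S.card ≤ Fintype.card κ ^ r * S.card ∧
        (energy g k S : ℝ) ≤ ((4 * k ^ 2) ^ r * S.card) ^ k := by
    intro r S hS
    refine ⟨Nat.le_mul_of_pos_left _ (by positivity), ?_⟩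
    calc (energy g k S : ℝ) ≤ (S.card : ℝ) ^ k := by exact_mod_cast energy_le_of_card_le_one g hS
      _ ≤ _ := by
        refine pow_le_pow_left₀ (by positivity) ?_ k
        exact le_mul_of_one_le_left (by positivity) (one_le_pow₀ hk1)
  induction r with
  | zero => exact fun S hS h => ⟨S, subset_rfl, hsmall 0 S h⟩
  | succ r ih =>
    rintro S hS (h | ⟨i, h⟩)
    · exact ⟨S, subset_rfl, hsmall _ S h⟩
    have hfib := fun n => ih (S.filter (v i · = n))
      (fun s hs => hS s (Finset.mem_of_mem_filter s hs)) (h n)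
    choose T hTS hTcard hTe using hfib
    have hTval : ∀ n, ∀ z ∈ T n, v i z = n := fun n z hz => (Finset.mem_filter.1 (hTS n hz)).2
    set T₀ := (S.image (v i)).biUnion T
    have hT₀S : T₀ ⊆ S :=
      Finset.biUnion_subset.2 fun n _ => (hTS n).trans (Finset.filter_subset _ _)
    have hT₀card : S.card ≤ Fintype.card κ ^ r * T₀.card := by
      rw [Finset.card_eq_sum_card_image (v i) S, Finset.card_biUnion, Finset.mul_sum]
      · exact Finset.sum_le_sum fun n _ => hTcard n
      · intro m _ n _ hmn
        refine Finset.disjoint_left.2 ?_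
        intro z hz hz'
        exact hmn ((hTval _ z hz).symm.trans (hTval _ z hz'))
    -- Only the most popular class of values of `v i` is kept.
    obtain ⟨c, -, hc⟩ := Finset.exists_max_image Finset.univ
      (fun c => (T₀.filter (fun z => cl i (v i z) = c)).card) Finset.univ_nonempty
    set T₁ := T₀.filter (fun z => cl i (v i z) = c)
    have hT₁S : T₁ ⊆ S := (Finset.filter_subset _ _).trans hT₀S
    have hT₁card : T₀.card ≤ Fintype.card κ * T₁.card := by
      rw [Finset.card_eq_sum_card_fiberwise (t := Finset.univ) (f := fun z => cl i (v i z))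
        (fun _ _ => Finset.mem_coe.2 (Finset.mem_univ _))]
      refine (Finset.sum_le_card_nsmul _ _ _ fun c' hc' => hc c' hc').trans (le_of_eq ?_)
      simp [T₁]
    refine ⟨T₁, hT₁S, ?_, ?_⟩
    · calc S.card ≤ Fintype.card κ ^ r * T₀.card := hT₀card
        _ ≤ Fintype.card κ ^ r * (Fintype.card κ * T₁.card) := by gcongr
        _ = _ := by ring
    have := energy_le_of_collision g hk (v i) T₁
      (fun x y hx hy hxy => hcol i x y (fun t => hS _ (hT₁S (hx t))) (fun t => hS _ (hT₁S (hy t)))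
        (by
          have hz : ∀ t, cl i (v i (Sum.elim x y t)) = c := by
            rintro (t | t)
            · exact (Finset.mem_filter.1 (hx t)).2
            · exact (Finset.mem_filter.1 (hy t)).2
          exact fun t u => (hz t).trans (hz u).symm) hxy)
      (c := (4 * k ^ 2) ^ r) (by positivity)
      (by
        intro n
        by_cases hn : n ∈ S.image (v i) ∧ cl i n = c
        · have : T₁.filter (v i · = n) = T n := by
            ext z
            simp only [T₁, T₀, Finset.mem_filter, Finset.mem_biUnion]
            constructor
            · rintro ⟨⟨⟨m, -, hz⟩, -⟩, hzn⟩
              obtain rfl : m = n := (hTval m z hz).symm.trans hzn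
              exact hz
            · intro hz
              exact ⟨⟨⟨n, hn.1, hz⟩, by rw [hTval n z hz]; exact hn.2⟩, hTval n z hz⟩
          rw [this]
          exact hTe n
        · have : T₁.filter (v i · = n) = ∅ := by
            refine Finset.filter_eq_empty_iff.2 fun z hz hzn => hn ?_
            refine ⟨?_, ?_⟩
            · rw [← hzn]; exact Finset.mem_image_of_mem _ (hT₁S hz)
            · rw [← hzn]; exact (Finset.mem_filter.1 hz).2
          rw [this]
          have h0 := energy_le_of_card_le_one g (k := k) (S := (∅ : Finset α)) (by simp)
          rw [Finset.card_empty, zero_pow (by omega)] at h0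
          rw [Nat.le_zero.1 h0]
          push_cast
          positivity)
    refine this.trans (le_of_eq ?_)
    ring

end DecisionTree

/-! ### Polynomial values in a valuation class -/

section Padic

open Polynomial

variable {p : ℕ} [hp : Fact p.Prime]

theorem padicNorm_mul_pow {c a : ℚ} (hc : c ≠ 0) (ha : a ≠ 0) (m : ℕ) :
    padicNorm p (c * a ^ m) = (p : ℚ) ^ (-(padicValRat p c + m * padicValRat p a)) := by
  rw [padicNorm.eq_zpow_of_nonzero (mul_ne_zero hc (pow_ne_zero _ ha)),
    padicValRat.mul hc (pow_ne_zero _ ha), padicValRat.pow]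

theorem padicNorm_prod_one_add_sub_one_lt {β : Type*} (T : Finset β) (x : β → ℚ) {ρ : ℚ}
    (hρ : 0 < ρ) (hρ1 : ρ ≤ 1) (hx : ∀ i ∈ T, padicNorm p (x i) < ρ) :
    padicNorm p (∏ i ∈ T, (1 + x i) - 1) < ρ := by
  classical
  induction T using Finset.induction_on with
  | empty => simpa using hρ
  | insert i T hi ih =>
    have h1 := ih fun j hj => hx j (Finset.mem_insert_of_mem hj)
    have h2 := hx i (Finset.mem_insert_self _ _)
    rw [Finset.prod_insert hi]
    have e : (1 + x i) * ∏ j ∈ T, (1 + x j) - 1 =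
        x i + (x i * (∏ j ∈ T, (1 + x j) - 1) + (∏ j ∈ T, (1 + x j) - 1)) := by ring
    rw [e]
    refine padicNorm.nonarchimedean.trans_lt (max_lt h2 ?_)
    refine padicNorm.nonarchimedean.trans_lt (max_lt ?_ h1)
    rw [padicNorm.mul]
    calc _ ≤ padicNorm p (x i) * 1 :=
          mul_le_mul_of_nonneg_left (h1.le.trans hρ1) (padicNorm.nonneg _)
      _ < ρ := by rwa [mul_one]

/-- A product of factors `1 + x i` is determined to first order by its dominant term. -/
theorem prod_one_add_ne_of_dominant {β γ : Type*} [DecidableEq β] (T : Finset β) (T' : Finset γ)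
    (x : β → ℚ) (x' : γ → ℚ) (i : β) (hi : i ∈ T) (hpos : 0 < padicNorm p (x i))
    (hone : padicNorm p (x i) < 1)
    (hx : ∀ j ∈ T, j ≠ i → padicNorm p (x j) < padicNorm p (x i))
    (hx' : ∀ j ∈ T', padicNorm p (x' j) < padicNorm p (x i)) :
    ∏ j ∈ T, (1 + x j) ≠ ∏ j ∈ T', (1 + x' j) := by
  intro heq
  have h1 := padicNorm_prod_one_add_sub_one_lt (T.erase i) x hpos hone.le
    fun j hj => hx j (Finset.mem_of_mem_erase hj) (Finset.ne_of_mem_erase hj)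
  have h2 := padicNorm_prod_one_add_sub_one_lt T' x' hpos hone.le hx'
  rw [← Finset.mul_prod_erase _ _ hi] at heq
  rw [← heq] at h2
  have h3 : padicNorm p (x i * (∏ j ∈ T.erase i, (1 + x j) - 1)) < padicNorm p (x i) := by
    rw [padicNorm.mul]
    exact mul_lt_of_lt_one_right hpos (h1.trans hone)
  have h4 : x i = ((1 + x i) * ∏ j ∈ T.erase i, (1 + x j) - 1) -
      ((∏ j ∈ T.erase i, (1 + x j) - 1) + x i * (∏ j ∈ T.erase i, (1 + x j) - 1)) := by ring
  have h5 : padicNorm p (x i) < padicNorm p (x i) := by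
    conv_lhs => rw [h4]
    exact padicNorm.sub.trans_lt (max_lt h2 (padicNorm.nonarchimedean.trans_lt (max_lt h1 h3)))
  exact lt_irrefl _ h5

/-- The `p`-adic valuation of the `m`-th term of `φ` at a point of valuation `j`. -/
def termVal (p : ℕ) (φ : ℚ[X]) (m : ℕ) (j : ℤ) : ℤ := padicValRat p (φ.coeff m) + m * j

/-- The class of a valuation `j` relative to `φ`. With tag `true`, the terms of index `m.1` and
`m.2` have equal valuation at points of valuation `j`; with tag `false`, the term of index `m.1`
is the dominant one and that of index `m.2` is the second. -/
def IsClassOf (p : ℕ) (φ : ℚ[X]) (j : ℤ) (m : (ℕ × ℕ) × Bool) : Prop :=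
  m.1.1 ∈ φ.support ∧ m.1.2 ∈ φ.support ∧ m.1.1 ≠ m.1.2 ∧
    ((m.2 = true ∧ termVal p φ m.1.1 j = termVal p φ m.1.2 j) ∨
      (m.2 = false ∧ termVal p φ m.1.1 j < termVal p φ m.1.2 j ∧
        ∀ n ∈ φ.support, n ≠ m.1.1 → n ≠ m.1.2 → termVal p φ m.1.2 j < termVal p φ n j))

theorem exists_isClassOf (p : ℕ) {φ : ℚ[X]} (hφ : φ.support.Nontrivial) (j : ℤ) :
    ∃ m, IsClassOf p φ j m := by
  by_cases htie : ∃ m ∈ φ.support, ∃ n ∈ φ.support, m ≠ n ∧ termVal p φ m j = termVal p φ n j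
  · obtain ⟨m, hm, n, hn, hmn, h⟩ := htie
    exact ⟨((m, n), true), hm, hn, hmn, Or.inl ⟨rfl, h⟩⟩
  push Not at htie
  obtain ⟨m, hm, hmin⟩ := Finset.exists_min_image φ.support (termVal p φ · j) hφ.nonempty
  obtain ⟨n, hn, hnmin⟩ := Finset.exists_min_image (φ.support.erase m) (termVal p φ · j)
    hφ.erase_nonempty
  obtain ⟨hnm, hn⟩ := Finset.mem_erase.1 hn
  refine ⟨((m, n), false), hm, hn, hnm.symm, Or.inr ⟨rfl, ?_, ?_⟩⟩
  · exact lt_of_le_of_ne (hmin n hn) (htie m hm n hn hnm.symm)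
  · intro l hl hlm hln
    exact lt_of_le_of_ne (hnmin l (Finset.mem_erase.2 ⟨hlm, hl⟩)) (htie n hn l hl (Ne.symm hln))

theorem IsClassOf.eq_of_true {p : ℕ} {φ : ℚ[X]} {j j' : ℤ} {m : ℕ × ℕ}
    (h : IsClassOf p φ j (m, true)) (h' : IsClassOf p φ j' (m, true)) : j = j' := by
  obtain ⟨-, -, hne, h⟩ := h
  obtain ⟨-, -, -, h'⟩ := h'
  have e := (h.resolve_right (by simp)).2
  have e' := (h'.resolve_right (by simp)).2
  simp only [termVal] at e e' hne
  have : ((m.1 : ℤ) - m.2) * (j - j') = 0 := by linear_combination e - e'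
  rcases mul_eq_zero.1 this with h0 | h0
  · exact absurd (by exact_mod_cast sub_eq_zero.1 h0) hne
  · exact sub_eq_zero.1 h0

/-- In a class with dominant term `m.1` and second term `m.2`, the polynomial equals its dominant
term times `1 + η`, where `η` is as large as the quotient of the two terms. -/
theorem IsClassOf.padicNorm_eq {φ : ℚ[X]} {m : ℕ × ℕ} {a : ℚ} (ha : a ≠ 0)
    (h : IsClassOf p φ (padicValRat p a) (m, false)) :
    padicNorm p (φ.eval a / (φ.coeff m.1 * a ^ m.1) - 1) =
      (p : ℚ) ^ (termVal p φ m.1 (padicValRat p a) - termVal p φ m.2 (padicValRat p a)) := by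
  obtain ⟨hm, hn, hne, h⟩ := h
  obtain ⟨-, hlt, hrest⟩ := h.resolve_left (by simp)
  simp only at hm hn hne hlt hrest
  have hp1 : (1 : ℚ) < p := by exact_mod_cast hp.out.one_lt
  have hnorm : ∀ l ∈ φ.support, padicNorm p (φ.coeff l * a ^ l) =
      (p : ℚ) ^ (-termVal p φ l (padicValRat p a)) := fun l hl =>
    padicNorm_mul_pow (mem_support_iff.1 hl) ha l
  have h0 : φ.coeff m.1 * a ^ m.1 ≠ 0 := mul_ne_zero (mem_support_iff.1 hm) (pow_ne_zero _ ha)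
  have hn' : m.2 ∈ φ.support.erase m.1 := Finset.mem_erase.2 ⟨hne.symm, hn⟩
  have e : φ.eval a / (φ.coeff m.1 * a ^ m.1) - 1 = (φ.coeff m.2 * a ^ m.2 +
      ∑ l ∈ (φ.support.erase m.1).erase m.2, φ.coeff l * a ^ l) / (φ.coeff m.1 * a ^ m.1) := by
    rw [eval_eq_sum, Polynomial.sum, ← Finset.add_sum_erase _ _ hm, ← Finset.add_sum_erase _ _ hn',
      div_sub_one h0, add_sub_cancel_left]
  have hsmall : padicNorm p (∑ l ∈ (φ.support.erase m.1).erase m.2, φ.coeff l * a ^ l) <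
      padicNorm p (φ.coeff m.2 * a ^ m.2) := by
    rw [hnorm _ hn]
    refine padicNorm.sum_lt' (fun l hl => ?_) (by positivity)
    obtain ⟨hl2, hl⟩ := Finset.mem_erase.1 hl
    obtain ⟨hl1, hl⟩ := Finset.mem_erase.1 hl
    rw [hnorm _ hl]
    exact zpow_lt_zpow_right₀ hp1 (neg_lt_neg (hrest l hl hl1 hl2))
  rw [e, padicNorm.div, padicNorm.add_eq_max_of_ne hsmall.ne', max_eq_left hsmall.le, hnorm _ hn,
    hnorm _ hm, ← zpow_sub₀ (by positivity)]
  congr 1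
  ring

/-- Within one class, a solution of the two product equations has two entries of equal
valuation: otherwise one of the factors `1 + η` would dominate all the others. -/
theorem exists_padicValRat_eq_of_prod_eq {φ : ℚ[X]} {k : ℕ} (hk : 2 ≤ k) (x y : Fin k → ℚ)
    (hx : ∀ t, x t ≠ 0) (hy : ∀ t, y t ≠ 0) (m : (ℕ × ℕ) × Bool)
    (hcl : ∀ t, IsClassOf p φ (padicValRat p (Sum.elim x y t)) m)
    (hprod : ∏ t, x t = ∏ t, y t) (hprodφ : ∏ t, φ.eval (x t) = ∏ t, φ.eval (y t)) :
    ∃ t u : Fin k ⊕ Fin k, t ≠ u ∧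
      padicValRat p (Sum.elim x y t) = padicValRat p (Sum.elim x y u) := by
  obtain ⟨m, b⟩ := m
  have hp1 : (1 : ℚ) < p := by exact_mod_cast hp.out.one_lt
  let i₀ : Fin k := ⟨0, by omega⟩
  cases b with
  | true => exact ⟨Sum.inl i₀, Sum.inr i₀, by simp, (hcl _).eq_of_true (hcl _)⟩
  | false =>
    by_contra hcon
    push Not at hcon
    set z := Sum.elim x y with hz
    have hz0 : ∀ t, z t ≠ 0 := by rintro (t | t) <;> simp [hz, hx, hy]
    set c := φ.coeff m.1 with hc
    have hc0 : c ≠ 0 := mem_support_iff.1 (hcl (Sum.inl i₀)).1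
    set η : Fin k ⊕ Fin k → ℚ := fun t => φ.eval (z t) / (c * z t ^ m.1) - 1 with hη
    have hφη : ∀ t, φ.eval (z t) = c * z t ^ m.1 * (1 + η t) := by
      intro t
      have := hz0 t
      simp only [hη]
      field_simp
      ring
    have heq : ∏ t, (1 + η (Sum.inl t)) = ∏ t, (1 + η (Sum.inr t)) := by
      have e1 : ∏ t, φ.eval (x t) = c ^ k * (∏ t, x t) ^ m.1 * ∏ t, (1 + η (Sum.inl t)) := by
        calc ∏ t, φ.eval (x t) = ∏ t, (c * x t ^ m.1 * (1 + η (Sum.inl t))) :=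
              Finset.prod_congr rfl fun t _ => hφη (Sum.inl t)
          _ = _ := by simp [Finset.prod_mul_distrib, Finset.prod_pow]
      have e2 : ∏ t, φ.eval (y t) = c ^ k * (∏ t, y t) ^ m.1 * ∏ t, (1 + η (Sum.inr t)) := by
        calc ∏ t, φ.eval (y t) = ∏ t, (c * y t ^ m.1 * (1 + η (Sum.inr t))) :=
              Finset.prod_congr rfl fun t _ => hφη (Sum.inr t)
          _ = _ := by simp [Finset.prod_mul_distrib, Finset.prod_pow]
      rw [e1, e2, ← hprod] at hprodφ
      refine mul_left_cancel₀ (mul_ne_zero (pow_ne_zero _ hc0) (pow_ne_zero _ ?_)) hprodφ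
      exact Finset.prod_ne_zero_iff.2 fun t _ => hx t
    -- The norm of `η t` is a power of `p` whose exponent is affine in the valuation, with slope
    -- `m.1 - m.2 ≠ 0`; distinct valuations therefore give distinct norms.
    have hnorm : ∀ t, padicNorm p (η t) =
        (p : ℚ) ^ (termVal p φ m.1 (padicValRat p (z t)) - termVal p φ m.2 (padicValRat p (z t))) :=
      fun t => (hcl t).padicNorm_eq (hz0 t)
    have hinj : ∀ t u, t ≠ u → padicNorm p (η t) ≠ padicNorm p (η u) := by
      intro t u htu he
      rw [hnorm, hnorm] at he
      have he := zpow_right_injective₀ (by positivity) hp1.ne' he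
      simp only [termVal] at he
      have h0 : ((m.1 : ℤ) - m.2) * (padicValRat p (z t) - padicValRat p (z u)) = 0 := by
        linear_combination he
      rcases mul_eq_zero.1 h0 with h0 | h0
      · exact (hcl t).2.2.1 (by exact_mod_cast sub_eq_zero.1 h0)
      · exact hcon t u htu (sub_eq_zero.1 h0)
    have hone : ∀ t, padicNorm p (η t) < 1 := by
      intro t
      obtain ⟨-, -, -, h⟩ := hcl t
      have := (h.resolve_left (by simp)).2.1
      rw [hnorm, ← zpow_zero (p : ℚ)]
      exact zpow_lt_zpow_right₀ hp1 (by simp only at this; omega)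
    have hpos : ∀ t, 0 < padicNorm p (η t) := fun t => by rw [hnorm]; positivity
    obtain ⟨t, -, ht⟩ := Finset.exists_max_image Finset.univ (fun t => padicNorm p (η t))
      ⟨Sum.inl i₀, Finset.mem_univ _⟩
    have hlt : ∀ u, u ≠ t → padicNorm p (η u) < padicNorm p (η t) := fun u hu =>
      lt_of_le_of_ne (ht u (Finset.mem_univ _)) (hinj u t hu)
    rcases t with t | t
    · exact prod_one_add_ne_of_dominant Finset.univ Finset.univ (fun t => η (Sum.inl t))
        (fun t => η (Sum.inr t)) t (Finset.mem_univ _) (hpos _) (hone _)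
        (fun u _ hu => hlt _ (by simpa using hu)) (fun u _ => hlt _ (by simp)) heq
    · exact prod_one_add_ne_of_dominant Finset.univ Finset.univ (fun t => η (Sum.inr t))
        (fun t => η (Sum.inl t)) t (Finset.mem_univ _) (hpos _) (hone _)
        (fun u _ hu => hlt _ (by simpa using hu)) (fun u _ => hlt _ (by simp)) heq.symm

end Padic

/-! ### Rational points on the graph of a polynomial -/

section Rational

open Polynomial

theorem eq_one_or_neg_one_of_padicValRat_eq_zero {q : ℚ} (hq : q ≠ 0)
    (h : ∀ p : Nat.Primes, padicValRat p q = 0) : q = 1 ∨ q = -1 := by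
  have hval : ∀ p : ℕ, p.Prime → padicValNat p q.num.natAbs = padicValNat p q.den := by
    intro p hp
    have := h ⟨p, hp⟩
    rw [padicValRat_def, padicValInt] at this
    simp only at this
    omega
  have hnum0 : q.num.natAbs ≠ 0 := by simpa using hq
  have hcop : ∀ p : ℕ, p.Prime → ¬ p ∣ q.num.natAbs ∧ ¬ p ∣ q.den := by
    intro p hp
    have := Fact.mk hp
    have h1 := hval p hp
    have e1 := dvd_iff_padicValNat_ne_zero (p := p) hnum0
    have e2 := dvd_iff_padicValNat_ne_zero (p := p) q.den_nz
    have h3 : ¬ (p ∣ q.num.natAbs ∧ p ∣ q.den) := fun ⟨ha, hb⟩ =>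
      hp.one_lt.ne' (Nat.dvd_one.1 (q.reduced ▸ Nat.dvd_gcd ha hb))
    rw [h1] at e1
    tauto
  have hnum : q.num.natAbs = 1 := Nat.eq_one_iff_not_exists_prime_dvd.2 fun p hp => (hcop p hp).1
  have hden : q.den = 1 := Nat.eq_one_iff_not_exists_prime_dvd.2 fun p hp => (hcop p hp).2
  rw [← Rat.num_div_den q, hden]
  rcases Int.natAbs_eq q.num with h1 | h1 <;> rw [h1, hnum] <;> simp

theorem card_le_two_of_padicValRat_const (T : Finset ℚˣ)
    (hT : ∀ p : Nat.Primes, ∀ x ∈ T, ∀ y ∈ T, padicValRat p (x : ℚ) = padicValRat p (y : ℚ)) :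
    T.card ≤ 2 := by
  rcases T.eq_empty_or_nonempty with rfl | ⟨x, hx⟩
  · simp
  have hsub : T ⊆ {x, -x} := by
    intro y hy
    have h1 := eq_one_or_neg_one_of_padicValRat_eq_zero (q := (y : ℚ) / x)
      (div_ne_zero y.ne_zero x.ne_zero) (fun p => by
        have := Fact.mk p.2
        rw [padicValRat.div y.ne_zero x.ne_zero, hT p y hy x hx, sub_self])
    rw [Finset.mem_insert, Finset.mem_singleton]
    rcases h1 with h1 | h1
    · left
      ext
      rwa [div_eq_one_iff_eq x.ne_zero] at h1
    · right
      ext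
      rw [div_eq_iff x.ne_zero] at h1
      simpa using h1
  exact (Finset.card_le_card hsub).trans Finset.card_le_two

/-- The graph map `a ↦ (a, φ a)` into `ℚˣ × ℚˣ`; a zero of `φ` is sent to `(a, 1)`. -/
noncomputable def graphMap (φ : ℚ[X]) (a : ℚˣ) : ℚˣ × ℚˣ :=
  (a, if h : φ.eval (a : ℚ) ≠ 0 then Units.mk0 _ h else 1)

theorem graphMap_snd {φ : ℚ[X]} {a : ℚˣ} (h : φ.eval (a : ℚ) ≠ 0) :
    ((graphMap φ a).2 : ℚ) = φ.eval (a : ℚ) := by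
  rw [graphMap, dif_pos h, Units.val_mk0]

theorem exists_fin_isClassOf {d : ℕ} (hd : 1 ≤ d) {φ : ℚ[X]} (hφ : φ.natDegree = d)
    (h0 : φ.eval 0 ≠ 0) (p : Nat.Primes) (j : ℤ) :
    ∃ c : (Fin (d + 1) × Fin (d + 1)) × Bool, IsClassOf p φ j ((c.1.1, c.1.2), c.2) := by
  have hsupp : φ.support.Nontrivial := by
    refine ⟨0, ?_, d, ?_, by omega⟩
    · simpa [coeff_zero_eq_eval_zero] using h0
    · have : φ ≠ 0 := by rintro rfl; simp at h0
      have := leadingCoeff_ne_zero.2 this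
      rw [leadingCoeff, hφ] at this
      simpa using this
  obtain ⟨⟨⟨m, n⟩, b⟩, h⟩ := exists_isClassOf p hsupp j
  have hm := le_natDegree_of_mem_supp _ h.1
  have hn := le_natDegree_of_mem_supp _ h.2.1
  rw [hφ] at hm hn
  simp only at hm hn
  exact ⟨((⟨m, by omega⟩, ⟨n, by omega⟩), b), h⟩

/-- A lower bound for the energy of the graph: by Cauchy–Schwarz, since all `k`-fold products of
its points lie in `Aᵏ × Aᵏ`. -/
theorem card_pow_le_card_pow_mul_energy {A T : Finset ℚˣ} {φ : ℚ[X]} (hTA : T ⊆ A)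
    (hφ : ∀ a ∈ T, (graphMap φ a).2 ∈ A) (k : ℕ) :
    (T.card ^ k) ^ 2 ≤ (A ^ k).card ^ 2 * energy (graphMap φ) k T := by
  classical
  set Z := Fintype.piFinset (fun _ : Fin k => T)
  let P : (Fin k → ℚˣ) → ℚˣ × ℚˣ := fun x => ∏ i, graphMap φ (x i)
  have hP : ∀ x ∈ Z, P x ∈ (A ^ k) ×ˢ (A ^ k) := by
    intro x hx
    have hx' := Fintype.mem_piFinset.1 hx
    have hpow : ∀ f : Fin k → ℚˣ, (∀ i, f i ∈ A) → ∏ i, f i ∈ A ^ k := by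
      intro f hf
      rw [← Finset.mem_coe, Finset.coe_pow]
      have := Set.finsetProd_mem_finsetProd Finset.univ (fun _ => (A : Set ℚˣ)) f fun i _ => hf i
      simpa using this
    rw [Finset.mem_product]
    refine ⟨?_, ?_⟩
    · rw [Prod.fst_prod]; exact hpow _ fun i => hTA (hx' i)
    · rw [Prod.snd_prod]; exact hpow _ fun i => hφ _ (hx' i)
  have h1 : Z.card = ∑ h ∈ (A ^ k) ×ˢ (A ^ k), (Z.filter (P · = h)).card :=
    Finset.card_eq_sum_card_fiberwise hP
  have h2 : energy (graphMap φ) k T = ∑ h ∈ (A ^ k) ×ˢ (A ^ k), (Z.filter (P · = h)).card ^ 2 := by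
    rw [energy, solutionCount, Finset.card_eq_sum_card_fiberwise (f := fun z => P z.1)
      (t := (A ^ k) ×ˢ (A ^ k))]
    · refine Finset.sum_congr rfl fun h _ => ?_
      rw [sq, ← Finset.card_product]
      congr 1
      ext z
      simp only [Finset.mem_filter, Finset.mem_product]
      constructor
      · rintro ⟨⟨⟨ha, hb⟩, hab⟩, hh⟩
        exact ⟨⟨ha, hh⟩, hb, hab.symm.trans hh⟩
      · rintro ⟨⟨ha, hh⟩, hb, hh'⟩
        exact ⟨⟨⟨ha, hb⟩, hh.trans hh'.symm⟩, hh⟩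
    · intro z hz
      have hz := Finset.mem_coe.1 hz
      exact hP _ (Finset.mem_product.1 (Finset.mem_filter.1 hz).1).1
  have h3 : Z.card = T.card ^ k := by simp [Z]
  rw [← h3, h2, h1]
  refine sq_sum_le_card_mul_sum_sq.trans (le_of_eq ?_)
  rw [Finset.card_product, sq (A ^ k).card, Nat.cast_id]

/-- The bound for sets of units: `S` is a set of elements of `A` that `φ` maps into `A`. -/
theorem card_le_of_polynomial_image_mem {d k : ℕ} (hd : 1 ≤ d) (hk : 2 ≤ k) {φ : ℚ[X]}
    (hφ : φ.natDegree = d) (h0 : φ.eval 0 ≠ 0) {K : ℝ} (hK : 1 ≤ K) {A S : Finset ℚˣ}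
    (hA : ((A * A).card : ℝ) ≤ K * A.card) (hSA : S ⊆ A)
    (hS : ∀ a ∈ S, φ.eval (a : ℚ) ≠ 0 ∧ (graphMap φ a).2 ∈ A) :
    (S.card : ℝ) ≤
      2 * K ^ (14 + 12 * (2 * (d + 1) ^ 2 * (4 * k ^ 2))) * (A.card : ℝ) ^ (2 / k : ℝ) := by
  classical
  rcases S.eq_empty_or_nonempty with rfl | hS₀
  · simp only [Finset.card_empty, Nat.cast_zero]; positivity
  have hA₀ : A.Nonempty := hS₀.mono hSA
  have hApos : (0 : ℝ) < A.card := by exact_mod_cast hA₀.card_pos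
  have hv : ∀ (p : Nat.Primes) (x y : ℚˣ), padicValRat p ((x * y : ℚˣ) : ℚ) =
      padicValRat p (x : ℚ) + padicValRat p (y : ℚ) := by
    intro p x y
    have := Fact.mk p.2
    rw [Units.val_mul, padicValRat.mul x.ne_zero y.ne_zero]
  obtain ⟨U, hUS, hU, B, hBS, r, hB, hr, hcard⟩ := exists_hasDepth_subset
    (fun (p : Nat.Primes) (x : ℚˣ) => padicValRat p (x : ℚ)) 2 S hS₀
    (fun T _ hT => card_le_two_of_padicValRat_const T hT)
  have hUcard : (U.card : ℝ) ≤ K ^ 12 := hU.card_le_of_small_doubling hv (hUS.trans hSA) hA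
  choose cl hcl using fun (p : Nat.Primes) (j : ℤ) => exists_fin_isClassOf hd hφ h0 p j
  obtain ⟨T, hTB, hBT, hTe⟩ := exists_subset_energy_le (graphMap φ) hk
    (fun (p : Nat.Primes) (x : ℚˣ) => padicValRat p (x : ℚ)) cl
    (fun a => φ.eval (a : ℚ) ≠ 0)
    (by
      intro p x y hx hy hc hprod
      have := Fact.mk p.2
      have hz : ∀ t, (((Sum.elim x y t : ℚˣ)) : ℚ) =
          Sum.elim (fun t => (x t : ℚ)) (fun t => (y t : ℚ)) t := by
        rintro (t | t) <;> rfl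
      simp only [hz] at hc ⊢
      have e1 := congrArg (fun w : ℚˣ × ℚˣ => (w.1 : ℚ)) hprod
      have e2 := congrArg (fun w : ℚˣ × ℚˣ => (w.2 : ℚ)) hprod
      simp only [Prod.fst_prod, Prod.snd_prod, Units.coe_prod] at e1 e2
      simp only [graphMap_snd (hx _), graphMap_snd (hy _)] at e2
      let c := cl p (padicValRat p (x ⟨0, by omega⟩ : ℚ))
      refine exists_padicValRat_eq_of_prod_eq hk _ _ (fun t => (x t).ne_zero)
        (fun t => (y t).ne_zero) ((c.1.1, c.1.2), c.2) (fun t => ?_) e1 e2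
      have := hc t (Sum.inl ⟨0, by omega⟩)
      have h2 := hcl p (padicValRat p
        (Sum.elim (fun t => (x t : ℚ)) (fun t => (y t : ℚ)) t))
      rw [this] at h2
      exact h2) r B (fun s hs => (hS s (hBS hs)).1) hB
  have hTS := hTB.trans hBS
  have hlow := card_pow_le_card_pow_mul_energy (hTS.trans hSA) (fun a ha => (hS a (hTS ha)).2) k
  have hAk : ((A ^ k).card : ℝ) ≤ K ^ k * A.card := by
    have h1 := (NNRat.cast_le (K := ℝ)).2 (Finset.pluennecke_ruzsa_inequality_pow_mul hA₀ A k)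
    push_cast at h1
    refine h1.trans ?_
    gcongr
    rw [div_le_iff₀ hApos]
    exact hA
  have hTpos : (0 : ℝ) < T.card := by
    have h1 := hS₀.card_pos
    have h2 : T.card ≠ 0 := by
      intro h
      rw [h, mul_zero] at hBT
      rw [Nat.le_zero.1 hBT] at hcard
      simp at hcard
      exact hS₀.ne_empty hcard
    exact_mod_cast Nat.pos_of_ne_zero h2
  have hk0 : (k : ℝ) ≠ 0 := by positivity
  have hT : (T.card : ℝ) ≤ K ^ 2 * (4 * k ^ 2) ^ r * (A.card : ℝ) ^ (2 / k : ℝ) := by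
    refine le_of_pow_le_pow_left₀ (n := k) (by omega) (by positivity) ?_
    have e : ((A.card : ℝ) ^ (2 / k : ℝ)) ^ k = (A.card : ℝ) ^ 2 := by
      rw [← Real.rpow_natCast, ← Real.rpow_mul hApos.le, div_mul_cancel₀ _ hk0]
      norm_cast
    rw [mul_pow, e]
    refine le_of_mul_le_mul_right ?_ (pow_pos hTpos k)
    calc (T.card : ℝ) ^ k * (T.card : ℝ) ^ k = ((T.card : ℝ) ^ k) ^ 2 := by ring
      _ ≤ ((A ^ k).card : ℝ) ^ 2 * energy (graphMap φ) k T := by exact_mod_cast hlow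
      _ ≤ (K ^ k * A.card) ^ 2 * ((4 * k ^ 2) ^ r * T.card) ^ k := by gcongr
      _ = _ := by ring
  set M := 2 * (d + 1) ^ 2 * (4 * k ^ 2) with hM
  have hκ : Fintype.card ((Fin (d + 1) × Fin (d + 1)) × Bool) = 2 * (d + 1) ^ 2 := by
    simp; ring
  have hMr : ((M : ℝ)) ^ r ≤ (K ^ 12) ^ M := by
    calc (M : ℝ) ^ r ≤ ((2 : ℝ) ^ M) ^ r := by
          gcongr
          exact_mod_cast Nat.lt_two_pow_self.le
      _ = ((2 : ℝ) ^ r) ^ M := by rw [← pow_mul, ← pow_mul, mul_comm]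
      _ ≤ (K ^ 12) ^ M := by
          gcongr
          exact le_trans (by exact_mod_cast hr) hUcard
  rw [hκ] at hBT
  calc (S.card : ℝ) ≤ 2 * B.card * U.card := by exact_mod_cast hcard
    _ ≤ 2 * ((2 * (d + 1) ^ 2) ^ r * T.card) * K ^ 12 := by
        gcongr
        exact_mod_cast hBT
    _ ≤ 2 * ((2 * (d + 1) ^ 2) ^ r * (K ^ 2 * (4 * k ^ 2) ^ r * (A.card : ℝ) ^ (2 / k : ℝ))) *
          K ^ 12 := by gcongr
    _ = 2 * K ^ 14 * (M : ℝ) ^ r * (A.card : ℝ) ^ (2 / k : ℝ) := by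
        rw [hM]; push_cast; rw [mul_pow _ (4 * (k : ℝ) ^ 2)]; ring
    _ ≤ 2 * K ^ 14 * (K ^ 12) ^ M * (A.card : ℝ) ^ (2 / k : ℝ) := by gcongr
    _ = _ := by rw [← pow_mul]; ring

end Rational

theorem theorem2p2 (d : ℕ) (hd : 1 ≤ d) (ε : ℝ) (hε : 0 < ε) :
    ∃ C : ℝ, 0 < C ∧ ∃ c : ℝ, 0 < c ∧
      ∀ (K : ℝ) (A : Finset ℚ) (φ : Polynomial ℚ),
        1 ≤ K →
        ((A * A).card : ℝ) ≤ K * (A.card : ℝ) →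
        φ.natDegree = d →
        φ.eval 0 ≠ 0 →
        (((A ×ˢ A).filter (fun p : ℚ × ℚ => p.1 = φ.eval p.2)).card : ℝ) ≤
          c * K ^ C * (A.card : ℝ) ^ ε := by
  obtain ⟨k, hk2, hkε⟩ : ∃ k : ℕ, 2 ≤ k ∧ (2 / k : ℝ) ≤ ε := by
    obtain ⟨n, hn⟩ := exists_nat_ge (2 / ε)
    refine ⟨n + 2, by omega, ?_⟩
    rw [div_le_iff₀ hε] at hn
    rw [div_le_iff₀ (by positivity)]
    push_cast
    nlinarith
  set e := 14 + 12 * (2 * (d + 1) ^ 2 * (4 * k ^ 2)) with he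
  refine ⟨e, by positivity, 1 + d + 2 * 2 ^ e, by positivity, ?_⟩
  intro K A φ hK hA hφ h0
  rw [Real.rpow_natCast]
  rcases A.eq_empty_or_nonempty with rfl | hA₀
  · simp only [Finset.product_empty, Finset.filter_empty, Finset.card_empty, Nat.cast_zero]
    positivity
  have hAcard : (1 : ℝ) ≤ A.card := by exact_mod_cast hA₀.card_pos
  have hφ0 : φ ≠ 0 := by rintro rfl; simp at h0
  set A₁ : Finset ℚˣ := A.preimage Units.val Units.val_injective.injOn with hA₁
  have hmem : ∀ a : ℚˣ, a ∈ A₁ ↔ (a : ℚ) ∈ A := fun a => Finset.mem_preimage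
  set S : Finset ℚˣ := A₁.filter fun a => φ.eval (a : ℚ) ≠ 0 ∧ φ.eval (a : ℚ) ∈ A with hSdef
  have hA₁A : A₁.card ≤ A.card := by
    rw [← Finset.card_image_of_injective A₁ Units.val_injective]
    refine Finset.card_le_card fun a ha => ?_
    obtain ⟨b, hb, rfl⟩ := Finset.mem_image.1 ha
    exact (hmem b).1 hb
  have hAA₁ : A.card ≤ A₁.card + 1 := by
    rw [← Finset.card_image_of_injective A₁ Units.val_injective]
    refine (Finset.card_le_card fun a ha => ?_).trans (Finset.card_insert_le 0 _)
    by_cases h : a = 0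
    · simp [h]
    · exact Finset.mem_insert_of_mem (Finset.mem_image.2 ⟨Units.mk0 a h, (hmem _).2 ha, rfl⟩)
  have hSbound : (S.card : ℝ) ≤ 2 * (2 * K) ^ e * (A.card : ℝ) ^ ε := by
    rcases S.eq_empty_or_nonempty with hS | ⟨s, hs⟩
    · rw [hS, Finset.card_empty, Nat.cast_zero]; positivity
    have hA₁pos : 1 ≤ A₁.card := Finset.card_pos.2 ⟨s, Finset.mem_of_mem_filter s hs⟩
    -- Removing `0` from `A` at most doubles the doubling constant.
    have hdoub : ((A₁ * A₁).card : ℝ) ≤ (2 * K) * A₁.card := by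
      have h1 : (A₁ * A₁).card ≤ (A * A).card := by
        rw [← Finset.card_image_of_injective (A₁ * A₁) Units.val_injective]
        refine Finset.card_le_card fun a ha => ?_
        obtain ⟨b, hb, rfl⟩ := Finset.mem_image.1 ha
        obtain ⟨x, hx, y, hy, rfl⟩ := Finset.mem_mul.1 hb
        exact Finset.mul_mem_mul ((hmem x).1 hx) ((hmem y).1 hy)
      have h2 : (A.card : ℝ) ≤ 2 * A₁.card := by
        have : A.card ≤ 2 * A₁.card := by omega
        exact_mod_cast this
      calc ((A₁ * A₁).card : ℝ) ≤ (A * A).card := by exact_mod_cast h1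
        _ ≤ K * A.card := hA
        _ ≤ K * (2 * A₁.card) := by gcongr
        _ = _ := by ring
    have := card_le_of_polynomial_image_mem hd hk2 hφ h0 (K := 2 * K) (by linarith) hdoub
      (Finset.filter_subset _ _ : S ⊆ A₁)
      (fun a ha => by
        obtain ⟨ha1, ha2, ha3⟩ := Finset.mem_filter.1 ha
        refine ⟨ha2, (hmem _).2 ?_⟩
        rwa [graphMap_snd ha2])
    refine this.trans ?_
    rw [← he]
    gcongr 2 * (2 * K) ^ e * ?_
    calc (A₁.card : ℝ) ^ (2 / k : ℝ) ≤ (A.card : ℝ) ^ (2 / k : ℝ) :=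
          Real.rpow_le_rpow (by positivity) (by exact_mod_cast hA₁A) (by positivity)
      _ ≤ _ := Real.rpow_le_rpow_of_exponent_le hAcard hkε
  have hcount : ((A ×ˢ A).filter (fun p : ℚ × ℚ => p.1 = φ.eval p.2)).card ≤ 1 + d + S.card := by
    have h1 : ((A ×ˢ A).filter (fun p : ℚ × ℚ => p.1 = φ.eval p.2)).card ≤
        (insert 0 (φ.roots.toFinset ∪ S.image Units.val)).card := by
      refine Finset.card_le_card_of_injOn Prod.snd ?_ ?_
      · intro q hq
        obtain ⟨hqA, hq⟩ := Finset.mem_filter.1 (Finset.mem_coe.1 hq)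
        obtain ⟨hq1, hq2⟩ := Finset.mem_product.1 hqA
        rw [hq] at hq1
        rw [Finset.mem_coe, Finset.mem_insert, Finset.mem_union]
        by_cases hz : q.2 = 0
        · exact Or.inl hz
        by_cases hr : φ.eval q.2 = 0
        · right; left
          rw [Multiset.mem_toFinset, Polynomial.mem_roots hφ0]
          exact hr
        · right; right
          refine Finset.mem_image.2 ⟨Units.mk0 q.2 hz, ?_, rfl⟩
          exact Finset.mem_filter.2 ⟨(hmem _).2 hq2, hr, hq1⟩
      · intro q hq q' hq' h
        have e1 := (Finset.mem_filter.1 (Finset.mem_coe.1 hq)).2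
        have e2 := (Finset.mem_filter.1 (Finset.mem_coe.1 hq')).2
        exact Prod.ext (by rw [e1, e2, h]) h
    have h2 : φ.roots.toFinset.card ≤ d :=
      (Multiset.toFinset_card_le _).trans (hφ ▸ Polynomial.card_roots' φ)
    have h3 := Finset.card_image_le (s := S) (f := (Units.val : ℚˣ → ℚ))
    have h4 := Finset.card_union_le φ.roots.toFinset (S.image Units.val)
    have h5 := Finset.card_insert_le 0 (φ.roots.toFinset ∪ S.image Units.val)
    omega
  have hKe : 1 ≤ K ^ e * (A.card : ℝ) ^ ε :=
    one_le_mul_of_one_le_of_one_le (one_le_pow₀ hK) (Real.one_le_rpow hAcard hε.le)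
  calc (((A ×ˢ A).filter (fun p : ℚ × ℚ => p.1 = φ.eval p.2)).card : ℝ)
      ≤ 1 + d + S.card := by exact_mod_cast hcount
    _ ≤ (1 + d) * (K ^ e * (A.card : ℝ) ^ ε) + 2 * (2 * K) ^ e * (A.card : ℝ) ^ ε :=
        add_le_add (le_mul_of_one_le_right (by positivity) hKe) hSbound
    _ = _ := by rw [mul_pow]; ring
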